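/- **Setting.** There are $K$ actions, $T$ rounds and an arbitrary context space $\mathcal X$. In round $t$ the environment selects (possibly randomly and adaptively) a context $x_t$, a loss vector $\ell_t\in[0,1]^K$ and a directed feedback graph $G_t=([K],E_t)$ that is strongly observable: each node $i$ has a self-loop, or $(j,i)\in E_t$ for all $j\ne i$. The learner sees $x_t$, chooses $i_t$, observes $\ell_{t,j}$ for $j\in A_t=\{j:(i_t,j)\in E_t\}$, and then observes the whole edge set $E_t$ (fully revealed graph). Let $\mathcal H_t$ be the information on all earlier rounds together with $x_t$ and the estimators $f_t,g_t$ below. **Assumptions.** (1) *Realizability.* There are classes $\mathcal F\subseteq(\mathcal X\times[K]\to[0,1])$ and $\mathcal G\subseteq(\mathcal X\times[K]\times[K]\to[0,1])$, and $f^\star\in\mathcal F$, $g^\star\in\mathcal G$, such that $\mathbb E[\ell_{t,i}\mid\mathcal H_t]=f^\star(x_t,i)$ and $\mathbb E[\mathbf 1\{(i,j)\in E_t\}\mid\mathcal H_t]=g^\star(x_t,i,j)$, and, given $\mathcal H_t$, the variables $\ell_{t,j}$ and $\mathbf 1\{(i,j)\in E_t\}$ are uncorrelated (e.g. $\ell_t$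 and $G_t$ are conditionally independent), for all $t,i,j$. (2) *Oracles.* A square loss oracle produces $f_t\in\mathrm{conv}(\mathcal F)$, a log loss oracle produces $g_t\in\mathrm{conv}(\mathcal G)$, and almost surely $$\sum_{t}\sum_{j\in A_t}(f_t(x_t,j)-\ell_{t,j})^2-\inf_{f\in\mathcal F}\sum_t\sum_{j\in A_t}(f(x_t,j)-\ell_{t,j})^2\le \mathrm{Reg}_{\mathrm{Sq}},$$ $$\sum_t\sum_{i,j}\ell_{\log}(g_t(x_t,i,j),\mathbf 1\{(i,j)\in E_t\})\le\inf_{g\in\mathcal G}\sum_t\sum_{i,j}\ell_{\log}(g(x_t,i,j),\mathbf 1\{(i,j)\in E_t\})+\mathrm{Reg}_{\mathrm{Log}},$$ where $\ell_{\log}(u,v)=v\log\frac1u+(1-v)\log\frac1{1-u}\in[0,\infty]$. Write $R=\max\{\mathrm{Reg}_{\mathrm{Sq}},\mathrm{Reg}_{\mathrm{Log}}\}$ and assume $R>0$. **Algorithm** (SquareCB.UG with parameter $\gamma$). In round $t$ the learner samples $i_t$ with fresh randomness from a distribution $p_t\in\arg\min_{p\in\Delta([K])}\mathsf{dec}_\gamma(p;f_t,g_t,x_t)$,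 where $$\mathsf{dec}_\gamma(p;f,g,x)=\sup_{i^\star\in[K],\,v\in[0,1]^K}\Big[\sum_i p_iv_i-v_{i^\star}-\frac\gamma4\sum_i p_i\sum_j g(x,i,j)(f(x,j)-v_j)^2\Big].$$ **Independence numbers.** For a directed graph $G$, $\alpha(G)$ is the largest size of a set of nodes no two distinct members of which are joined by an edge. Let $\alpha_t=\inf_q\mathbb E_{G\sim q}[\alpha(G)]$, the infimum over all distributions $q$ of strongly observable graphs with $\Pr_{([K],E)\sim q}[(i,j)\in E]=g^\star(x_t,i,j)$ for all $i,j$. Let $A=\mathbb E\big[\sum_{t=1}^T\alpha_t\big]$ (so $A=\sum_t\alpha_t$ when this sum is not random). **Theorem.** There is a universal constant $C>0$ such that SquareCB.UG with $\gamma=\max\{12,\sqrt{A/R}\}$ guarantees $$\mathrm{Reg}_{\mathrm{CB}}=\mathbb E\Big[\sum_{t=1}^T\big(f^\star(x_t,i_t)-\min_i f^\star(x_t,i)\big)\Big]\le C\,\log(K\gamma)\,\sqrt{A\,R}.$$ In particular the regret is $\tilde O(\sqrt{A\,R})$, with logarithmic factors in $K,T$ only, as soon as $R$ is at least an inverse polynomial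 in $KT$: for every $c\ge0$ with $R\ge(KT)^{-c}$, $$\mathrm{Reg}_{\mathrm{CB}}\le C(1+c)\log(KT)\sqrt{A\,R}.$$ -/

import Mathlib

open MeasureTheory Finset
open scoped ENNReal

universe u v

/-! Contextual bandits with uninformed, fully revealed directed feedback graphs.
The action set is `Fin K`; a feedback graph is given by its set of directed edges. -/

/-- A directed graph on the node set `Fin K` (self-loops allowed), given by its edge set. -/
abbrev FeedbackGraph (K : ℕ) : Type := Finset (Fin K × Fin K)

namespace FeedbackGraph

variable {K : ℕ}

/-- The entry `(i, j)` of the adjacency matrix, i.e. the indicator of `(i, j) ∈ E`. -/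
def ind (E : FeedbackGraph K) (i j : Fin K) : ℝ := if (i, j) ∈ E then 1 else 0

/-- The out-neighbourhood `{j : (i, j) ∈ E}`: the actions observed when `i` is played. -/
def out (E : FeedbackGraph K) (i : Fin K) : Finset (Fin K) :=
  univ.filter fun j => (i, j) ∈ E

/-- Every node has a self-loop or is observed by all the other nodes. -/
def StronglyObservable (E : FeedbackGraph K) : Prop :=
  ∀ i : Fin K, (i, i) ∈ E ∨ ∀ j : Fin K, j ≠ i → (j, i) ∈ E

/-- No two distinct nodes of `S` are joined by an edge, in either direction. -/
def IsIndep (E : FeedbackGraph K) (S : Finset (Fin K)) : Prop :=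
  ∀ i ∈ S, ∀ j ∈ S, i ≠ j → (i, j) ∉ E

open Classical in
/-- The independence number of a directed graph. -/
noncomputable def indepNum (E : FeedbackGraph K) : ℕ :=
  (univ.filter fun S : Finset (Fin K) => E.IsIndep S).sup Finset.card

end FeedbackGraph

section Environment

variable {K : ℕ}

/-- `graphLaws M`: the distributions of strongly observable graphs whose expected adjacency
matrix is `M`. A distribution is given by its vector of probabilities. -/
def graphLaws (M : Fin K → Fin K → ℝ) : Set (FeedbackGraph K → ℝ) :=
  {q | q ∈ stdSimplex ℝ (FeedbackGraph K) ∧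
    (∀ E, q E ≠ 0 → E.StronglyObservable) ∧
    ∀ i j, ∑ E, q E * E.ind i j = M i j}

/-- The independence number `α(g, x)`: the infimum of the expected independence number over all
distributions of strongly observable graphs with mean graph `g x`. -/
noncomputable def expIndepNum {X : Type u} (g : X → Fin K → Fin K → ℝ) (x : X) : ℝ :=
  sInf ((fun q : FeedbackGraph K → ℝ => ∑ E, q E * (E.indepNum : ℝ)) '' graphLaws (g x))

/-- The decision-estimation coefficient `dec_γ(p; f, g, x)`, a supremum over `i⋆ ∈ [K]` and
`v⋆ ∈ [0, 1]^K`. -/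
noncomputable def dec {X : Type u} (γ : ℝ) (p : Fin K → ℝ) (f : X → Fin K → ℝ)
    (g : X → Fin K → Fin K → ℝ) (x : X) : ℝ :=
  ⨆ s : Fin K × {v : Fin K → ℝ // ∀ j, v j ∈ Set.Icc (0 : ℝ) 1},
    (∑ i, p i * s.2.1 i - s.2.1 s.1
      - γ / 4 * ∑ i, p i * ∑ j, g x i j * (f x j - s.2.1 j) ^ 2)

/-- `log (1 / u)` for `u ∈ [0, 1]`, with value `∞` at `u = 0`. -/
noncomputable def logInv (u : ℝ) : ℝ≥0∞ := if u = 0 then ⊤ else ENNReal.ofReal (Real.log (1 / u))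

/-- The log loss `v log (1 / u) + (1 - v) log (1 / (1 - u))` for `u, v ∈ [0, 1]`, as an element of
`[0, ∞]` (with `0 * ∞ = 0`). -/
noncomputable def logLoss (u v : ℝ) : ℝ≥0∞ :=
  ENNReal.ofReal v * logInv u + ENNReal.ofReal (1 - v) * logInv (1 - u)

/-- All random quantities of one interaction; the rounds are numbered `0, 1, 2, …`. -/
structure Play (K : ℕ) (X : Type u) (Ω : Type v) where
  /-- the context `x_t` -/
  ctx : ℕ → Ω → X
  /-- the loss vector `ℓ_t` -/
  loss : ℕ → Ω → Fin K → ℝ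
  /-- the feedback graph `G_t` -/
  graph : ℕ → Ω → FeedbackGraph K
  /-- the estimator `f_t` produced by the square loss regression oracle -/
  lossEst : ℕ → Ω → X → Fin K → ℝ
  /-- the estimator `g_t` produced by the log loss regression oracle -/
  graphEst : ℕ → Ω → X → Fin K → Fin K → ℝ
  /-- the distribution `p_t` computed by the learner -/
  strat : ℕ → Ω → Fin K → ℝ
  /-- the action `i_t` of the learner -/
  act : ℕ → Ω → Fin K

variable {X : Type u} {Ω : Type v} [MeasurableSpace X] [mΩ : MeasurableSpace Ω]

/-- The order of events. `ℋ t` is the information available in round `t` once the context `x_t` is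
known and the two oracles have produced `f_t` and `g_t`: it contains everything that happened in
the earlier rounds (and possibly the internal randomness of the environment and of the oracles). -/
structure Play.IsInteraction (P : Play K X Ω) (T : ℕ) (ℋ : Filtration ℕ mΩ) : Prop where
  ctx_meas : ∀ t < T, Measurable[ℋ t] (P.ctx t)
  lossEst_meas : ∀ t < T, ∀ i, Measurable[ℋ t] fun ω => P.lossEst t ω (P.ctx t ω) i
  graphEst_meas : ∀ t < T, ∀ i j, Measurable[ℋ t] fun ω => P.graphEst t ω (P.ctx t ω) i j
  strat_meas : ∀ t < T, Measurable[ℋ t] (P.strat t)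
  loss_meas : ∀ t < T, Measurable[ℋ (t + 1)] (P.loss t)
  graph_meas : ∀ t < T, Measurable[ℋ (t + 1), ⊤] (P.graph t)
  act_meas : ∀ t < T, Measurable[ℋ (t + 1)] (P.act t)
  loss_mem : ∀ t < T, ∀ ω i, P.loss t ω i ∈ Set.Icc (0 : ℝ) 1
  graph_obs : ∀ t < T, ∀ ω, (P.graph t ω).StronglyObservable

/-- The information after the environment has decided `ℓ_t` and `G_t`, just before the learner
samples her action. -/
abbrev Play.beforeAct (P : Play K X Ω) (ℋ : Filtration ℕ mΩ) (t : ℕ) : MeasurableSpace Ω :=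
  ℋ t ⊔ MeasurableSpace.comap (P.loss t) inferInstance ⊔ MeasurableSpace.comap (P.graph t) ⊤

/-- The learner runs `SquareCB.UG` with parameter `γ`: `p_t` minimizes `dec_γ(·; f_t, g_t, x_t)` over
the probability vectors, and `i_t` is sampled from `p_t` with fresh randomness. -/
structure Play.IsSquareCBUG (P : Play K X Ω) (T : ℕ) (ℋ : Filtration ℕ mΩ) (μ : Measure Ω)
    (γ : ℝ) : Prop where
  strat_mem : ∀ t < T, ∀ ω, P.strat t ω ∈ stdSimplex ℝ (Fin K)
  strat_argmin : ∀ t < T, ∀ ω, ∀ p ∈ stdSimplex ℝ (Fin K),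
    dec γ (P.strat t ω) (P.lossEst t ω) (P.graphEst t ω) (P.ctx t ω)
      ≤ dec γ p (P.lossEst t ω) (P.graphEst t ω) (P.ctx t ω)
  act_sample : ∀ t < T, ∀ i,
    μ[fun ω => if P.act t ω = i then (1 : ℝ) else 0 | P.beforeAct ℋ t]
      =ᵐ[μ] fun ω => P.strat t ω i

/-- Realizability of the mean loss and of the mean graph, by `fs ∈ 𝓕` and `gs ∈ 𝓖`: given the
information `ℋ t`, the mean of `ℓ_t` is `fs(x_t, ·)`, the mean adjacency matrix of `G_t` is
`gs(x_t, ·, ·)`, and the loss of an action is uncorrelated with its being observed. -/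
structure Play.IsRealizable (P : Play K X Ω) (T : ℕ) (ℋ : Filtration ℕ mΩ) (μ : Measure Ω)
    (𝓕 : Set (X → Fin K → ℝ)) (𝓖 : Set (X → Fin K → Fin K → ℝ))
    (fs : X → Fin K → ℝ) (gs : X → Fin K → Fin K → ℝ) : Prop where
  class_loss : ∀ f ∈ 𝓕, ∀ x i, f x i ∈ Set.Icc (0 : ℝ) 1
  class_graph : ∀ g ∈ 𝓖, ∀ x i j, g x i j ∈ Set.Icc (0 : ℝ) 1
  fs_mem : fs ∈ 𝓕
  gs_mem : gs ∈ 𝓖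
  mean_loss : ∀ t < T, ∀ i,
    μ[fun ω => P.loss t ω i | ℋ t] =ᵐ[μ] fun ω => fs (P.ctx t ω) i
  mean_graph : ∀ t < T, ∀ i j,
    μ[fun ω => (P.graph t ω).ind i j | ℋ t] =ᵐ[μ] fun ω => gs (P.ctx t ω) i j
  uncorrelated : ∀ t < T, ∀ i j,
    μ[fun ω => (P.graph t ω).ind i j * P.loss t ω j | ℋ t]
      =ᵐ[μ] fun ω => gs (P.ctx t ω) i j * fs (P.ctx t ω) j

/-- The set `A_t` of actions whose loss is observed in round `t`. -/
def Play.observed (P : Play K X Ω) (t : ℕ) (ω : Ω) : Finset (Fin K) :=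
  (P.graph t ω).out (P.act t ω)

/-- The square loss oracle outputs elements of the convex hull of `𝓕` and, on the data
`{(j, ℓ_{t,j}) : j ∈ A_t}` that it is fed, its regret against `𝓕` is at most `regSq`. -/
structure Play.SquareLossOracle (P : Play K X Ω) (T : ℕ) (μ : Measure Ω)
    (𝓕 : Set (X → Fin K → ℝ)) (regSq : ℝ) : Prop where
  mem_hull : ∀ t < T, ∀ ω, P.lossEst t ω ∈ convexHull ℝ 𝓕
  regret_le : ∀ᵐ ω ∂μ,
    ∑ t ∈ range T, ∑ j ∈ P.observed t ω, (P.lossEst t ω (P.ctx t ω) j - P.loss t ω j) ^ 2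
      - ⨅ f : 𝓕, ∑ t ∈ range T, ∑ j ∈ P.observed t ω, (f.1 (P.ctx t ω) j - P.loss t ω j) ^ 2
      ≤ regSq

/-- The log loss oracle outputs elements of the convex hull of `𝓖` and, on the data
`{(i, j, 1{(i, j) ∈ E_t}) : i, j ∈ [K]}` that it is fed when the graph is fully revealed, its regret
against `𝓖` is at most `regLog`. -/
structure Play.LogLossOracle (P : Play K X Ω) (T : ℕ) (μ : Measure Ω)
    (𝓖 : Set (X → Fin K → Fin K → ℝ)) (regLog : ℝ) : Prop where
  mem_hull : ∀ t < T, ∀ ω, P.graphEst t ω ∈ convexHull ℝ 𝓖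
  regret_le : ∀ᵐ ω ∂μ,
    ∑ t ∈ range T, ∑ i, ∑ j,
        logLoss (P.graphEst t ω (P.ctx t ω) i j) ((P.graph t ω).ind i j)
      ≤ (⨅ g : 𝓖, ∑ t ∈ range T, ∑ i, ∑ j,
            logLoss (g.1 (P.ctx t ω) i j) ((P.graph t ω).ind i j))
        + ENNReal.ofReal regLog

/-- The expected regret of the learner over `T` rounds. -/
noncomputable def Play.regret (P : Play K X Ω) (T : ℕ) (μ : Measure Ω)
    (fs : X → Fin K → ℝ) : ℝ :=
  ∫ ω, ∑ t ∈ range T, (fs (P.ctx t ω) (P.act t ω) - ⨅ i, fs (P.ctx t ω) i) ∂μ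

/-- The sum over the rounds of `α_t = α(gs, x_t)`, averaged over the randomness of the contexts; it
is just `∑ α_t` when that sum is not random. -/
noncomputable def Play.sumIndep (P : Play K X Ω) (T : ℕ) (μ : Measure Ω)
    (gs : X → Fin K → Fin K → ℝ) : ℝ :=
  ∫ ω, ∑ t ∈ range T, expIndepNum gs (P.ctx t ω) ∂μ

end Environment

/-! ### Independence numbers and weighted in-degrees -/

namespace FeedbackGraph

variable {K : ℕ} (E : FeedbackGraph K)

/-! Evaluating `dec` at the true loss vector bounds the regret of a round by the value of `dec` at
the chosen `p_t` plus `γ / 4` times the squared error of `f_t`, weighted by `p_t` and `g_t`. It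
remains to bound the minimum of `dec`, to pass from `g_t` to the true mean graph, and to control the
estimation errors by the oracle regrets.

Value of the decision problem. For a mean graph `M` put `W_j = ∑ i, p i * M i j`. Maximising over
`v` leaves, for each comparator `s`, a function of `p` with a linear part and the part `(2 / γ) ∑ j,
(p_j - 1{j = s})² / W_j`, which is convex. By a minimax argument
(`exists_forall_le_add_of_forall_mixture`) it suffices to answer a known prior `ρ` on comparators,
and the answer is `ρ` mixed with a fraction `1 / γ` of uniform exploration. The averaged numerators
are then at most `4 p_j (1 - p_j)` (`sum_mul_sq_sub_single_le`), which leaves `∑ j, p_j (1 - p_j) /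
W_j`. Convexity of `1 / x` reduces this to single strongly observable graphs
(`graphLaws.sum_div_le`). There, nodes with a self-loop are handled by a weighted Caro–Wei bound and
greedy peeling, which give `α log`; for a node without self-loop the factor `1 - p_j` cancels the
observation probability exactly. The result is `graphLaws.exists_decision`, of order `E_q[α] log (K
γ) / γ`.

Change of graph. Since `a ≤ 2 b + 2 (√a - √b)²`, replacing `g_t` by the true mean graph, or
conversely, costs a factor 2 and a Hellinger-type distance (`sum_mul_sq_le_add_hellinger`). The
factor is harmless, and the distance enters to first order, multiplied by `γ`.

Estimation. The conditional expected excess log loss is a sum of Bernoulli Kullback–Leibler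
divergences, which dominate squared Hellinger distances, so the log loss regret bounds the
accumulated distance (`sum_integral_hellinger_le`). Sampling with fresh randomness and the lack of
correlation turn the expected excess square loss into the squared error weighted by `p_t` and the
true mean graph (`sum_integral_sqError_le`).

Summing over rounds gives `49 log (K γ) A / γ + (5 / 4) γ R`, and `γ = √(A / R)` balances the two
terms. When this ratio is below 12, the trivial bound `T ≤ A` is enough. -/

lemma IsIndep.card_le_indepNum {E : FeedbackGraph K} {S : Finset (Fin K)} (h : E.IsIndep S) :
    S.card ≤ E.indepNum := by
  classical
  unfold indepNum
  exact Finset.le_sup (f := Finset.card) (by simpa using h)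

lemma indepNum_le : E.indepNum ≤ K := by
  classical
  unfold indepNum
  exact Finset.sup_le fun S _ => by simpa using S.card_le_univ

lemma one_le_indepNum (hK : 0 < K) : 1 ≤ E.indepNum := by
  have h : E.IsIndep {(⟨0, hK⟩ : Fin K)} := by
    intro i hi j hj hij
    simp only [Finset.mem_singleton] at hi hj
    exact absurd (hi.trans hj.symm) hij
  simpa using h.card_le_indepNum

lemma ind_nonneg (i j : Fin K) : 0 ≤ E.ind i j := by
  unfold ind; split_ifs <;> norm_num

lemma ind_le_one (i j : Fin K) : E.ind i j ≤ 1 := by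
  unfold ind; split_ifs <;> norm_num

/-- The total weight in `S` of the closed undirected neighbourhood of `i`. -/
def nbrWeight (S : Finset (Fin K)) (w : Fin K → ℝ) (i : Fin K) : ℝ :=
  ∑ j ∈ S.filter fun j => j = i ∨ (i, j) ∈ E ∨ (j, i) ∈ E, w j

/-- The total weight in `S` of the closed in-neighbourhood of `i`. -/
def inWeight (S : Finset (Fin K)) (w : Fin K → ℝ) (i : Fin K) : ℝ :=
  ∑ j ∈ S.filter fun j => j = i ∨ (j, i) ∈ E, w j

variable {E}

lemma le_nbrWeight {S : Finset (Fin K)} {w : Fin K → ℝ} (hw : ∀ i ∈ S, 0 < w i) {i : Fin K}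
    (hi : i ∈ S) : w i ≤ E.nbrWeight S w i :=
  Finset.single_le_sum (f := w) (fun j hj => (hw j (Finset.mem_filter.1 hj).1).le) (by simp [hi])

lemma le_inWeight {S : Finset (Fin K)} {w : Fin K → ℝ} (hw : ∀ i ∈ S, 0 < w i) {i : Fin K}
    (hi : i ∈ S) : w i ≤ E.inWeight S w i :=
  Finset.single_le_sum (f := w) (fun j hj => (hw j (Finset.mem_filter.1 hj).1).le) (by simp [hi])

lemma nbrWeight_mono {S S' : Finset (Fin K)} {w : Fin K → ℝ} (hw : ∀ i ∈ S, 0 < w i)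
    (h : S' ⊆ S) (i : Fin K) : E.nbrWeight S' w i ≤ E.nbrWeight S w i :=
  Finset.sum_le_sum_of_subset_of_nonneg (Finset.filter_subset_filter _ h)
    fun j hj _ => (hw j (Finset.mem_filter.1 hj).1).le

lemma inWeight_mono {S S' : Finset (Fin K)} {w : Fin K → ℝ} (hw : ∀ i ∈ S, 0 < w i)
    (h : S' ⊆ S) (i : Fin K) : E.inWeight S' w i ≤ E.inWeight S w i :=
  Finset.sum_le_sum_of_subset_of_nonneg (Finset.filter_subset_filter _ h)
    fun j hj _ => (hw j (Finset.mem_filter.1 hj).1).le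

/-- A weighted Caro–Wei bound: greedily pick the vertex of smallest closed neighbourhood. -/
lemma exists_isIndep_sum_div_nbrWeight_le (w : Fin K → ℝ) (S : Finset (Fin K))
    (hw : ∀ i ∈ S, 0 < w i) :
    ∃ I ⊆ S, E.IsIndep I ∧ ∑ i ∈ S, w i / E.nbrWeight S w i ≤ I.card := by
  classical
  induction S using Finset.strongInduction with
  | H S ih =>
    rcases S.eq_empty_or_nonempty with rfl | hS
    · exact ⟨∅, by simp, by simp [IsIndep], by simp⟩
    obtain ⟨i, hi, hmin⟩ := S.exists_min_image (fun i => E.nbrWeight S w i) hS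
    set N := S.filter fun j => j = i ∨ (i, j) ∈ E ∨ (j, i) ∈ E with hN
    set S' := S.filter fun j => ¬ (j = i ∨ (i, j) ∈ E ∨ (j, i) ∈ E) with hS'
    have hsub : S' ⊆ S := Finset.filter_subset _ _
    have hiS' : i ∉ S' := by simp [hS']
    obtain ⟨I, hIS, hI, hle⟩ := ih S' (Finset.ssubset_iff_subset_ne.2
      ⟨hsub, fun h => hiS' (h ▸ hi)⟩) fun j hj => hw j (hsub hj)
    have hnot : ∀ j ∈ I, ¬ (j = i ∨ (i, j) ∈ E ∨ (j, i) ∈ E) := fun j hj =>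
      (Finset.mem_filter.1 (hIS hj)).2
    refine ⟨insert i I, Finset.insert_subset hi (hIS.trans hsub), ?_, ?_⟩
    · intro a ha b hb hab
      rw [Finset.mem_insert] at ha hb
      rcases ha with rfl | ha <;> rcases hb with rfl | hb
      · exact absurd rfl hab
      · exact fun h => hnot b hb (Or.inr (Or.inl h))
      · exact fun h => hnot a ha (Or.inr (Or.inr h))
      · exact hI a ha b hb hab
    · have hpos : 0 < E.nbrWeight S w i := (hw i hi).trans_le (le_nbrWeight hw hi)
      -- By minimality of `i`, every denominator on `N` is at least the total weight of `N`, so the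
      -- removed vertices contribute at most the 1 by which the independent set grows.
      have h1 : ∑ j ∈ N, w j / E.nbrWeight S w j ≤ 1 := by
        calc ∑ j ∈ N, w j / E.nbrWeight S w j ≤ ∑ j ∈ N, w j / E.nbrWeight S w i := by
              refine Finset.sum_le_sum fun j hj => ?_
              have hjS := (Finset.mem_filter.1 hj).1
              exact div_le_div_of_nonneg_left (hw j hjS).le hpos (hmin j hjS)
          _ = 1 := by
              rw [← Finset.sum_div]
              exact div_self hpos.ne'
      -- Deleting vertices only shrinks neighbourhoods, hence only increases the ratios of the
      -- survivors.
      have h2 : ∑ j ∈ S', w j / E.nbrWeight S w j ≤ I.card := by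
        refine le_trans (Finset.sum_le_sum fun j hj => ?_) hle
        have hjS := hsub hj
        exact div_le_div_of_nonneg_left (hw j hjS).le
          ((hw j hjS).trans_le (le_nbrWeight (fun k hk => hw k (hsub hk)) hj))
          (nbrWeight_mono hw hsub j)
      rw [Finset.card_insert_of_notMem fun h => hiS' (hIS h),
        ← Finset.sum_filter_add_sum_filter_not S
          (fun j => j = i ∨ (i, j) ∈ E ∨ (j, i) ∈ E)]
      push_cast
      linarith

/-- A neighbour is an in-neighbour or an out-neighbour, and summing `w i * w j` over out-edges or
over in-edges gives the same total by exchanging `i` and `j`. -/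
lemma sum_mul_nbrWeight_le (w : Fin K → ℝ) (S : Finset (Fin K)) (hw : ∀ i ∈ S, 0 < w i) :
    ∑ i ∈ S, w i * E.nbrWeight S w i ≤ 2 * ∑ i ∈ S, w i * E.inWeight S w i := by
  have hswap : ∑ i ∈ S, w i * E.inWeight S w i
      = ∑ i ∈ S, ∑ j ∈ S, if i = j ∨ (i, j) ∈ E then w i * w j else 0 := by
    rw [Finset.sum_comm]
    refine Finset.sum_congr rfl fun i _ => ?_
    rw [inWeight, Finset.mul_sum, Finset.sum_filter]
    exact Finset.sum_congr rfl fun j _ => by split_ifs <;> ring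
  have hin : ∑ i ∈ S, w i * E.inWeight S w i
      = ∑ i ∈ S, ∑ j ∈ S, if j = i ∨ (j, i) ∈ E then w i * w j else 0 := by
    refine Finset.sum_congr rfl fun i _ => ?_
    rw [inWeight, Finset.mul_sum, Finset.sum_filter]
  rw [two_mul]
  nth_rewrite 1 [hin]
  rw [hswap, ← Finset.sum_add_distrib]
  refine Finset.sum_le_sum fun i hi => ?_
  rw [← Finset.sum_add_distrib, nbrWeight, Finset.mul_sum, Finset.sum_filter]
  refine Finset.sum_le_sum fun j hj => ?_
  have := mul_pos (hw i hi) (hw j hj)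
  split_ifs <;> first | linarith | (exfalso; grind)

/-- Some vertex has an in-neighbourhood of weight at least the average `1 / (2 α)`. -/
lemma exists_le_mul_inWeight (w : Fin K → ℝ) {S : Finset (Fin K)} (hS : S.Nonempty)
    (hw : ∀ i ∈ S, 0 < w i) :
    ∃ i ∈ S, ∑ j ∈ S, w j ≤ 2 * E.indepNum * E.inWeight S w i := by
  by_contra! hcon
  obtain ⟨I, -, hI, hle⟩ := exists_isIndep_sum_div_nbrWeight_le (E := E) w S hw
  have hle' : ∑ i ∈ S, w i / E.nbrWeight S w i ≤ E.indepNum :=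
    hle.trans (by exact_mod_cast hI.card_le_indepNum)
  have hnb : ∀ i ∈ S, 0 < E.nbrWeight S w i := fun i hi => (hw i hi).trans_le (le_nbrWeight hw hi)
  -- With `w(S)` the total weight, Cauchy–Schwarz and the Caro–Wei bound give `w(S)² ≤ α ∑ w *
  -- nbrWeight ≤ 2 α ∑ w * inWeight`, whereas averaging the negated claim with weights `w` makes the
  -- last quantity smaller than `w(S)²`.
  have hcs : (∑ i ∈ S, w i) ^ 2
      ≤ (∑ i ∈ S, w i / E.nbrWeight S w i) * ∑ i ∈ S, w i * E.nbrWeight S w i := by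
    refine Finset.sum_sq_le_sum_mul_sum_of_sq_le_mul S
      (fun i hi => div_nonneg (hw i hi).le (hnb i hi).le)
      (fun i hi => mul_nonneg (hw i hi).le (hnb i hi).le) fun i hi => le_of_eq ?_
    have := (hnb i hi).ne'
    field_simp
  have h2 := sum_mul_nbrWeight_le (E := E) w S hw
  have h0 : 0 ≤ ∑ i ∈ S, w i * E.nbrWeight S w i :=
    Finset.sum_nonneg fun i hi => mul_nonneg (hw i hi).le (hnb i hi).le
  have h3 : ∑ i ∈ S, w i * (2 * E.indepNum * E.inWeight S w i) < ∑ i ∈ S, w i * ∑ j ∈ S, w j :=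
    Finset.sum_lt_sum_of_nonempty hS fun i hi => mul_lt_mul_of_pos_left (hcon i hi) (hw i hi)
  have h4 : ∑ i ∈ S, w i * (2 * E.indepNum * E.inWeight S w i)
      = E.indepNum * (2 * ∑ i ∈ S, w i * E.inWeight S w i) := by
    rw [Finset.mul_sum, Finset.mul_sum]
    exact Finset.sum_congr rfl fun i _ => by ring
  rw [← Finset.sum_mul, h4] at h3
  have hα : (0 : ℝ) ≤ E.indepNum := Nat.cast_nonneg _
  nlinarith [mul_le_mul_of_nonneg_left h2 hα, mul_le_mul_of_nonneg_right hle' h0]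

/-- Peel off the vertex given by `exists_le_mul_inWeight`: its ratio is at most `2 α` times its
share of the remaining weight. These shares are bounded by the decrements of the logarithm of the
remaining weight, which telescope down to a last vertex of weight at least `ε`; that vertex accounts
for the 1. -/
lemma sum_div_inWeight_le (w : Fin K → ℝ) {ε : ℝ} (hε : 0 < ε) {S : Finset (Fin K)}
    (hS : S.Nonempty) (hw : ∀ i ∈ S, ε ≤ w i) :
    ∑ i ∈ S, w i / E.inWeight S w i
      ≤ 2 * E.indepNum * (1 + Real.log ((∑ i ∈ S, w i) / ε)) := by
  classical
  induction S using Finset.strongInduction with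
  | H S ih =>
    have hw0 : ∀ i ∈ S, 0 < w i := fun i hi => hε.trans_le (hw i hi)
    obtain ⟨i, hi, hle⟩ := exists_le_mul_inWeight (E := E) w hS hw0
    have hα : (0 : ℝ) ≤ E.indepNum := Nat.cast_nonneg _
    have hin := (hw0 i hi).trans_le (le_inWeight (E := E) hw0 hi)
    have hsum : 0 < ∑ j ∈ S, w j := Finset.sum_pos hw0 hS
    have h1 : w i / E.inWeight S w i ≤ 2 * E.indepNum * (w i / ∑ j ∈ S, w j) := by
      rw [← mul_div_assoc, div_le_div_iff₀ hin hsum]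
      nlinarith [mul_le_mul_of_nonneg_left hle (hw0 i hi).le]
    have hsplit := Finset.add_sum_erase S w hi
    rw [← Finset.add_sum_erase S _ hi]
    rcases (S.erase i).eq_empty_or_nonempty with he | hne
    · rw [he, Finset.sum_empty, add_zero] at hsplit ⊢
      refine h1.trans ?_
      rw [← hsplit, div_self (hw0 i hi).ne']
      have : 0 ≤ Real.log (w i / ε) := Real.log_nonneg ((one_le_div hε).2 (hw i hi))
      nlinarith
    · have hsub : S.erase i ⊆ S := Finset.erase_subset i S
      have h2 := ih (S.erase i) (Finset.erase_ssubset hi) hne fun j hj => hw j (hsub hj)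
      have hsum' : 0 < ∑ j ∈ S.erase i, w j := Finset.sum_pos (fun j hj => hw0 j (hsub hj)) hne
      have h3 : ∑ j ∈ S.erase i, w j / E.inWeight S w j
          ≤ ∑ j ∈ S.erase i, w j / E.inWeight (S.erase i) w j := by
        refine Finset.sum_le_sum fun j hj => ?_
        exact div_le_div_of_nonneg_left (hw0 j (hsub hj)).le
          ((hw0 j (hsub hj)).trans_le (le_inWeight (fun k hk => hw0 k (hsub hk)) hj))
          (inWeight_mono hw0 hsub j)
      have h4 : w i / ∑ j ∈ S, w j
          ≤ Real.log ((∑ j ∈ S, w j) / ε) - Real.log ((∑ j ∈ S.erase i, w j) / ε) := by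
        rw [← Real.log_div (by positivity) (by positivity)]
        -- At the ratio of the total weights before and after the removal, `1 - 1 / x` is exactly
        -- the share of `i`.
        have h5 := Real.one_sub_inv_le_log_of_pos
          (x := (∑ j ∈ S, w j) / ε / ((∑ j ∈ S.erase i, w j) / ε)) (by positivity)
        refine le_trans (le_of_eq ?_) h5
        field_simp
        linarith
      nlinarith [mul_le_mul_of_nonneg_left h4 hα]

/-- The probability that `j` is observed in the graph `E` when an action is drawn from `p`. -/
def obsProb (E : FeedbackGraph K) (p : Fin K → ℝ) (j : Fin K) : ℝ := ∑ i, p i * E.ind i j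

lemma obsProb_nonneg {p : Fin K → ℝ} (hp : ∀ i, 0 ≤ p i) (j : Fin K) : 0 ≤ E.obsProb p j :=
  Finset.sum_nonneg fun i _ => mul_nonneg (hp i) (E.ind_nonneg i j)

lemma obsProb_eq_of_forall {p : Fin K → ℝ} (hp : p ∈ stdSimplex ℝ (Fin K)) {j : Fin K}
    (hj : ∀ i, i ≠ j → (i, j) ∈ E) (hjj : (j, j) ∉ E) : E.obsProb p j = 1 - p j := by
  classical
  rw [obsProb, ← hp.2, ← Finset.add_sum_erase _ _ (Finset.mem_univ j),
    ← Finset.add_sum_erase _ p (Finset.mem_univ j)]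
  have : ∑ i ∈ univ.erase j, p i * E.ind i j = ∑ i ∈ univ.erase j, p i :=
    Finset.sum_congr rfl fun i hi => by simp [ind, hj i (Finset.ne_of_mem_erase hi)]
  rw [this]
  simp [ind, hjj]

lemma inWeight_le_obsProb {p : Fin K → ℝ} (hp : ∀ i, 0 ≤ p i) (S : Finset (Fin K)) {j : Fin K}
    (hjj : (j, j) ∈ E) : E.inWeight S p j ≤ E.obsProb p j := by
  rw [inWeight, obsProb, Finset.sum_filter]
  calc ∑ i ∈ S, (if i = j ∨ (i, j) ∈ E then p i else 0)
      ≤ ∑ i, (if i = j ∨ (i, j) ∈ E then p i else 0) :=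
        Finset.sum_le_sum_of_subset_of_nonneg (Finset.subset_univ _) fun i _ _ => by
          split_ifs
          exacts [hp i, le_rfl]
    _ ≤ ∑ i, p i * E.ind i j := by
        refine Finset.sum_le_sum fun i _ => ?_
        unfold ind
        split_ifs with h1 h2 h2
        · simp
        · rcases h1 with rfl | h1
          exacts [absurd hjj h2, absurd h1 h2]
        · simpa using hp i
        · simp

lemma StronglyObservable.obsProb_pos (hE : E.StronglyObservable) {p : Fin K → ℝ}
    (hp : p ∈ stdSimplex ℝ (Fin K)) (hp0 : ∀ i, 0 < p i) (hp1 : ∀ i, p i < 1) (j : Fin K) :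
    0 < E.obsProb p j := by
  by_cases hjj : (j, j) ∈ E
  · exact (hp0 j).trans_le ((le_inWeight (E := E) (fun i _ => hp0 i) (Finset.mem_univ j)).trans
      (inWeight_le_obsProb hp.1 univ hjj))
  · rw [obsProb_eq_of_forall hp ((hE j).resolve_left hjj) hjj]
    linarith [hp1 j]

/-- The numerator `1 - p j` is what makes strong observability sufficient: a node without self-loop
is seen with probability `1 - p j`, so its term is just `p j`, and these sum to at most 1. Looped
nodes give `2 α (1 + log (1 / ε))`; the extra 1 is absorbed because `α ≥ 1`. -/
lemma StronglyObservable.sum_div_obsProb_le (hE : E.StronglyObservable) {p : Fin K → ℝ}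
    (hp : p ∈ stdSimplex ℝ (Fin K)) {ε : ℝ} (hε : 0 < ε) (hpε : ∀ i, ε ≤ p i)
    (hp1 : ∀ i, p i < 1) :
    ∑ j, p j * (1 - p j) / E.obsProb p j ≤ 3 * E.indepNum * (1 + Real.log (1 / ε)) := by
  classical
  have hp0 : ∀ i, 0 < p i := fun i => hε.trans_le (hpε i)
  have hK : 0 < K := by
    rcases K.eq_zero_or_pos with rfl | h
    · simpa using hp.2
    · exact h
  have hε1 : ε ≤ 1 := (hpε ⟨0, hK⟩).trans (hp1 _).le
  have hlog : 0 ≤ Real.log (1 / ε) := Real.log_nonneg ((one_le_div hε).2 hε1)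
  have hα : (1 : ℝ) ≤ E.indepNum := by exact_mod_cast E.one_le_indepNum hK
  set S := univ.filter fun j : Fin K => (j, j) ∈ E with hS
  have hloop : ∑ j ∈ S, p j * (1 - p j) / E.obsProb p j
      ≤ 2 * E.indepNum * (1 + Real.log (1 / ε)) := by
    rcases S.eq_empty_or_nonempty with he | hne
    · rw [he, Finset.sum_empty]; positivity
    have hsum1 : ∑ i ∈ S, p i ≤ 1 := by
      rw [← hp.2]
      exact Finset.sum_le_sum_of_subset_of_nonneg (Finset.subset_univ _) fun i _ _ => hp.1 i
    have hsum0 : 0 < ∑ i ∈ S, p i := Finset.sum_pos (fun i _ => hp0 i) hne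
    calc ∑ j ∈ S, p j * (1 - p j) / E.obsProb p j ≤ ∑ j ∈ S, p j / E.inWeight S p j := by
          refine Finset.sum_le_sum fun j hj => ?_
          have hjj := (Finset.mem_filter.1 hj).2
          exact div_le_div₀ (hp0 j).le (by nlinarith [hp0 j])
            ((hp0 j).trans_le (le_inWeight (fun i _ => hp0 i) hj))
            (inWeight_le_obsProb hp.1 S hjj)
      _ ≤ 2 * E.indepNum * (1 + Real.log ((∑ i ∈ S, p i) / ε)) :=
          sum_div_inWeight_le p hε hne fun i _ => hpε i
      _ ≤ _ := by gcongr
  have hnoloop : ∑ j ∈ univ.filter (fun j : Fin K => ¬ (j, j) ∈ E), p j * (1 - p j) / E.obsProb p j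
      ≤ 1 := by
    calc ∑ j ∈ univ.filter (fun j : Fin K => ¬ (j, j) ∈ E), p j * (1 - p j) / E.obsProb p j
        = ∑ j ∈ univ.filter (fun j : Fin K => ¬ (j, j) ∈ E), p j := by
          refine Finset.sum_congr rfl fun j hj => ?_
          have hjj := (Finset.mem_filter.1 hj).2
          rw [obsProb_eq_of_forall hp ((hE j).resolve_left hjj) hjj]
          exact mul_div_cancel_right₀ _ (by linarith [hp1 j])
      _ ≤ ∑ j, p j :=
          Finset.sum_le_sum_of_subset_of_nonneg (Finset.subset_univ _) fun i _ _ => hp.1 i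
      _ = 1 := hp.2
  rw [← Finset.sum_filter_add_sum_filter_not univ fun j : Fin K => (j, j) ∈ E]
  nlinarith

end FeedbackGraph

/-! ### A minimax inequality -/

/-- If every mixture of finitely many convex functions is somewhere at most `B`, then they are
simultaneously at most `B + ε` somewhere. -/
lemma exists_forall_le_add_of_forall_mixture {V ι : Type*} [AddCommGroup V] [Module ℝ V]
    [Fintype ι] [Nonempty ι] {S : Set V} {Φ : ι → V → ℝ} (hΦ : ∀ i, ConvexOn ℝ S (Φ i)) {B : ℝ}
    (h : ∀ ρ ∈ stdSimplex ℝ ι, ∃ p ∈ S, ∑ i, ρ i * Φ i p ≤ B) {ε : ℝ} (hε : 0 < ε) :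
    ∃ p ∈ S, ∀ i, Φ i p ≤ B + ε := by
  classical
  by_contra! hcon
  -- `U` is the convex set of value vectors dominating an attainable one, `W` an open orthant. The
  -- negated claim says that they are disjoint, and a separating functional will provide the mixture
  -- contradicting `h`.
  let U : Set (ι → ℝ) := {y | ∃ p ∈ S, ∀ i, Φ i p ≤ y i}
  let W : Set (ι → ℝ) := Set.univ.pi fun _ => Set.Iio (B + ε)
  have hU : Convex ℝ U := by
    rintro y ⟨p, hp, hy⟩ z ⟨q, hq, hz⟩ a b ha hb hab
    refine ⟨a • p + b • q, (hΦ (Classical.arbitrary ι)).1 hp hq ha hb hab, fun i => ?_⟩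
    refine ((hΦ i).2 hp hq ha hb hab).trans ?_
    simp only [smul_eq_mul, Pi.add_apply, Pi.smul_apply]
    exact add_le_add (mul_le_mul_of_nonneg_left (hy i) ha) (mul_le_mul_of_nonneg_left (hz i) hb)
  have hW : Convex ℝ W := convex_pi fun _ _ => convex_Iio _
  have hWo : IsOpen W := isOpen_set_pi Set.finite_univ fun _ _ => isOpen_Iio
  have hdisj : Disjoint W U := by
    rw [Set.disjoint_left]
    rintro y hy ⟨p, hp, hpy⟩
    obtain ⟨i, hi⟩ := hcon p hp
    exact absurd (hi.trans_le (hpy i)) (not_lt.2 (hy i trivial).le)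
  obtain ⟨F, s, hFW, hFU⟩ := geometric_hahn_banach_open hW hWo hU hdisj
  let c : ι → ℝ := fun i => F (Pi.single i 1)
  have hF : ∀ y, F y = ∑ i, c i * y i := by
    intro y
    conv_lhs => rw [pi_eq_sum_univ' y]
    rw [map_sum]
    refine Finset.sum_congr rfl fun i _ => ?_
    rw [map_smul, smul_eq_mul, mul_comm]
  -- `W` is stable under decreasing a coordinate, so a negative coefficient would make `F` unbounded
  -- above on `W`.
  have hc : ∀ i, 0 ≤ c i := by
    intro i
    by_contra! hneg
    have hmem : ∀ t : ℝ, 0 ≤ t → (fun _ => B) - t • Pi.single i 1 ∈ W := by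
      intro t ht j _
      simp only [Set.mem_Iio, Pi.sub_apply, Pi.smul_apply, smul_eq_mul, Pi.single_apply]
      split_ifs <;> linarith
    have h1 := hFW _ (hmem ((|s| + |F fun _ => B|) / -c i) (by
      have : 0 < -c i := by linarith
      positivity))
    rw [map_sub, map_smul, smul_eq_mul] at h1
    change (F fun _ => B) - (|s| + |F fun _ => B|) / -c i * c i < s at h1
    rw [div_neg, neg_mul, div_mul_cancel₀ _ hneg.ne] at h1
    linarith [neg_abs_le (F fun _ => B), le_abs_self s]
  have hhalf : (fun _ => B + ε / 2) ∈ W := fun j _ => by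
    simp only [Set.mem_Iio]; linarith
  have hsum : 0 < ∑ i, c i := by
    refine lt_of_le_of_ne (Finset.sum_nonneg fun i _ => hc i) fun h0 => ?_
    have hz : ∀ i, c i = 0 := fun i =>
      (Finset.sum_eq_zero_iff_of_nonneg fun i _ => hc i).1 h0.symm i (Finset.mem_univ i)
    obtain ⟨p, hp, -⟩ := h (Pi.single (Classical.arbitrary ι) 1) (single_mem_stdSimplex ℝ _)
    have h1 := hFU (fun i => Φ i p) ⟨p, hp, fun _ => le_rfl⟩
    have h2 := hFW _ hhalf
    rw [hF] at h1 h2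
    simp only [hz, zero_mul, Finset.sum_const_zero] at h1 h2
    linarith
  -- The normalised coefficients form a mixture; the point where it is at most `B` lies on the wrong
  -- side of the hyperplane, since the constant vector `B + ε / 2` is still in `W`.
  obtain ⟨p, hp, hpB⟩ := h (fun i => c i / ∑ j, c j)
    ⟨fun i => div_nonneg (hc i) hsum.le, by rw [← Finset.sum_div, div_self hsum.ne']⟩
  have h1 := hFU (fun i => Φ i p) ⟨p, hp, fun _ => le_rfl⟩
  have h2 := hFW _ hhalf
  rw [hF] at h1 h2
  have h3 : ∑ i, c i / (∑ j, c j) * Φ i p = (∑ i, c i * Φ i p) / ∑ j, c j := by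
    rw [Finset.sum_div]
    exact Finset.sum_congr rfl fun i _ => by ring
  rw [h3, div_le_iff₀ hsum] at hpB
  rw [← Finset.sum_mul] at h2
  nlinarith

/-- The function `(x, y) ↦ x ^ 2 / y` is jointly convex for `y > 0`. -/
lemma sq_div_convex {x₁ x₂ y₁ y₂ a b : ℝ} (hy₁ : 0 < y₁) (hy₂ : 0 < y₂) (ha : 0 ≤ a) (hb : 0 ≤ b)
    (hab : a + b = 1) :
    (a * x₁ + b * x₂) ^ 2 / (a * y₁ + b * y₂) ≤ a * (x₁ ^ 2 / y₁) + b * (x₂ ^ 2 / y₂) := by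
  have hy : 0 < a * y₁ + b * y₂ := by
    rcases ha.eq_or_lt with rfl | ha'
    · have : b = 1 := by linarith
      subst this; linarith
    · nlinarith [mul_pos ha' hy₁, mul_nonneg hb hy₂.le]
  have key : a * (x₁ ^ 2 / y₁) + b * (x₂ ^ 2 / y₂) - (a * x₁ + b * x₂) ^ 2 / (a * y₁ + b * y₂)
      = a * b * (x₁ * y₂ - x₂ * y₁) ^ 2 / (y₁ * y₂ * (a * y₁ + b * y₂)) := by
    field_simp
    ring
  have : 0 ≤ a * b * (x₁ * y₂ - x₂ * y₁) ^ 2 / (y₁ * y₂ * (a * y₁ + b * y₂)) := by positivity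
  linarith

/-! ### The value of the decision-estimation problem for a mean graph -/

section Decision

variable {K : ℕ} {M : Fin K → Fin K → ℝ} {q : FeedbackGraph K → ℝ}

lemma graphLaws.sum_mul_eq (hq : q ∈ graphLaws M) (p : Fin K → ℝ) (j : Fin K) :
    ∑ i, p i * M i j = ∑ E, q E * E.obsProb p j := by
  simp_rw [FeedbackGraph.obsProb, Finset.mul_sum]
  rw [Finset.sum_comm]
  refine Finset.sum_congr rfl fun i _ => ?_
  rw [← hq.2.2 i j, Finset.mul_sum]
  exact Finset.sum_congr rfl fun E _ => by ring

lemma graphLaws.mem_Icc (hq : q ∈ graphLaws M) (i j : Fin K) : M i j ∈ Set.Icc (0 : ℝ) 1 := by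
  rw [← hq.2.2 i j]
  refine ⟨Finset.sum_nonneg fun E _ => mul_nonneg (hq.1.1 E) (E.ind_nonneg i j), ?_⟩
  rw [← hq.1.2]
  exact Finset.sum_le_sum fun E _ => mul_le_of_le_one_right (hq.1.1 E) (E.ind_le_one i j)

lemma graphLaws.one_le_sum_indepNum (hK : 0 < K) (hq : q ∈ graphLaws M) :
    1 ≤ ∑ E, q E * (E.indepNum : ℝ) := by
  rw [← hq.1.2]
  exact Finset.sum_le_sum fun E _ => le_mul_of_one_le_right (hq.1.1 E)
    (by exact_mod_cast E.one_le_indepNum hK)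

lemma graphLaws.sum_indepNum_le (hq : q ∈ graphLaws M) :
    ∑ E, q E * (E.indepNum : ℝ) ≤ K := by
  calc ∑ E, q E * (E.indepNum : ℝ) ≤ ∑ E, q E * (K : ℝ) :=
        Finset.sum_le_sum fun E _ => mul_le_mul_of_nonneg_left
          (by exact_mod_cast E.indepNum_le) (hq.1.1 E)
    _ = K := by rw [← Finset.sum_mul, hq.1.2, one_mul]

lemma graphLaws.sum_mul_pos (hq : q ∈ graphLaws M) {p : Fin K → ℝ}
    (hp : p ∈ stdSimplex ℝ (Fin K)) (hp0 : ∀ i, 0 < p i) (hp1 : ∀ i, p i < 1) (j : Fin K) :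
    0 < ∑ i, p i * M i j := by
  rw [graphLaws.sum_mul_eq hq]
  obtain ⟨E, -, hE⟩ := Finset.exists_ne_zero_of_sum_ne_zero (hq.1.2 ▸ one_ne_zero : ∑ E, q E ≠ 0)
  refine lt_of_lt_of_le (mul_pos ((hq.1.1 E).lt_of_ne' hE)
    ((hq.2.1 E hE).obsProb_pos hp hp0 hp1 j)) ?_
  exact Finset.single_le_sum (f := fun E => q E * E.obsProb p j)
    (fun E _ => mul_nonneg (hq.1.1 E) (FeedbackGraph.obsProb_nonneg hp.1 j)) (Finset.mem_univ E)

/-- The denominator is the `q`-average of `obsProb`, so Jensen's inequality for `1 / x`, here in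
Cauchy–Schwarz form, moves the average outside the quotient, and the bound for a single graph
applies on the support of `q`. -/
lemma graphLaws.sum_div_le (hq : q ∈ graphLaws M) {p : Fin K → ℝ}
    (hp : p ∈ stdSimplex ℝ (Fin K)) {ε : ℝ} (hε : 0 < ε) (hpε : ∀ i, ε ≤ p i)
    (hp1 : ∀ i, p i < 1) :
    ∑ j, p j * (1 - p j) / ∑ i, p i * M i j
      ≤ 3 * (∑ E, q E * (E.indepNum : ℝ)) * (1 + Real.log (1 / ε)) := by
  have hp0 : ∀ i, 0 < p i := fun i => hε.trans_le (hpε i)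
  have hterm : ∀ j, p j * (1 - p j) / ∑ i, p i * M i j
      ≤ ∑ E, q E * (p j * (1 - p j) / E.obsProb p j) := by
    intro j
    have hW := graphLaws.sum_mul_pos hq hp hp0 hp1 j
    have hcs : (∑ E, q E) ^ 2
        ≤ (∑ E, q E * E.obsProb p j) * ∑ E, q E / E.obsProb p j := by
      refine Finset.sum_sq_le_sum_mul_sum_of_sq_le_mul _
        (fun E _ => mul_nonneg (hq.1.1 E) (FeedbackGraph.obsProb_nonneg hp.1 j))
        (fun E _ => div_nonneg (hq.1.1 E) (FeedbackGraph.obsProb_nonneg hp.1 j))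
        fun E _ => le_of_eq ?_
      by_cases hE : q E = 0
      · simp [hE]
      · have := ((hq.2.1 E hE).obsProb_pos hp hp0 hp1 j).ne'
        field_simp
    rw [hq.1.2, ← graphLaws.sum_mul_eq hq, one_pow] at hcs
    have hn : 0 ≤ p j * (1 - p j) := mul_nonneg (hp0 j).le (by linarith [hp1 j])
    have h2 : ∑ E, q E * (p j * (1 - p j) / E.obsProb p j)
        = p j * (1 - p j) * ∑ E, q E / E.obsProb p j := by
      rw [Finset.mul_sum]
      exact Finset.sum_congr rfl fun E _ => by ring
    rw [h2, div_le_iff₀ hW, mul_assoc]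
    refine le_mul_of_one_le_right hn ?_
    rwa [mul_comm]
  refine (Finset.sum_le_sum fun j _ => hterm j).trans ?_
  rw [Finset.sum_comm, Finset.mul_sum, Finset.sum_mul]
  refine Finset.sum_le_sum fun E _ => ?_
  rw [← Finset.mul_sum]
  by_cases hE : q E = 0
  · simp [hE]
  · calc q E * ∑ j, p j * (1 - p j) / E.obsProb p j
        ≤ q E * (3 * E.indepNum * (1 + Real.log (1 / ε))) :=
          mul_le_mul_of_nonneg_left ((hq.2.1 E hE).sum_div_obsProb_le hp hε hpε hp1) (hq.1.1 E)
      _ = _ := by ring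

/-- Completing the square in the loss vector `v`. -/
lemma decision_gap_le {γ : ℝ} (hγ : 0 < γ) {p f W : Fin K → ℝ} (hW : ∀ j, 0 < W j)
    (s : Fin K) (v : Fin K → ℝ) :
    ∑ i, p i * v i - v s - γ / 8 * ∑ j, W j * (f j - v j) ^ 2
      ≤ ∑ i, p i * f i - f s + 2 / γ * ∑ j, (p j - Pi.single (M := fun _ => ℝ) s 1 j) ^ 2 / W j := by
  classical
  have hs : ∀ u : Fin K → ℝ, u s = ∑ j, Pi.single (M := fun _ => ℝ) s 1 j * u j := by
    intro u; simp [Pi.single_apply]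
  rw [hs v, hs f, Finset.mul_sum, Finset.mul_sum, ← Finset.sum_sub_distrib,
    ← Finset.sum_sub_distrib, ← Finset.sum_sub_distrib, ← Finset.sum_add_distrib]
  refine Finset.sum_le_sum fun j _ => ?_
  set e := Pi.single (M := fun _ => ℝ) s 1 j
  have hWj := hW j
  have key : p j * f j - e * f j + 2 / γ * ((p j - e) ^ 2 / W j)
      - (p j * v j - e * v j - γ / 8 * (W j * (f j - v j) ^ 2))
      = (4 * (p j - e) + γ * W j * (f j - v j)) ^ 2 / (8 * γ * W j) := by
    field_simp
    ring
  have : 0 ≤ (4 * (p j - e) + γ * W j * (f j - v j)) ^ 2 / (8 * γ * W j) := by positivity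
  linarith

/-- The probability vectors obtained by mixing a fraction `δ` of uniform exploration satisfy the
variance estimate `∑ₛ ρ s (p j - 1{j = s})² ≤ 4 p j (1 - p j)`. -/
lemma sum_mul_sq_sub_single_le {ρ p : Fin K → ℝ} (hρ : ρ ∈ stdSimplex ℝ (Fin K)) {δ c : ℝ}
    (hδ0 : 0 ≤ δ) (hδ : δ ≤ 1 / 12) (hc0 : 0 ≤ c) (hc1 : c ≤ 1)
    (hp : ∀ j, p j = (1 - δ) * ρ j + δ * c) (j : Fin K) :
    ∑ s, ρ s * (p j - Pi.single (M := fun _ => ℝ) s 1 j) ^ 2 ≤ 4 * (p j * (1 - p j)) := by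
  classical
  have h1 : ∑ s, ρ s * (p j - Pi.single (M := fun _ => ℝ) s 1 j) ^ 2
      = p j ^ 2 + (1 - 2 * p j) * ρ j := by
    have : ∀ s, ρ s * (p j - Pi.single (M := fun _ => ℝ) s 1 j) ^ 2
        = p j ^ 2 * ρ s + (1 - 2 * p j) * (if j = s then ρ s else 0) := by
      intro s
      rw [Pi.single_apply]
      split_ifs <;> ring
    rw [Finset.sum_congr rfl fun s _ => this s, Finset.sum_add_distrib, ← Finset.mul_sum,
      ← Finset.mul_sum, hρ.2]
    simp
  rw [h1]
  have hρ0 := hρ.1 j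
  have hρ1 : ρ j ≤ 1 := by
    rw [← hρ.2]; exact Finset.single_le_sum (fun i _ => hρ.1 i) (Finset.mem_univ j)
  have hpj := hp j
  have ha : (1 - δ) * ρ j ≤ p j := by rw [hpj]; nlinarith
  have hb : (1 - δ) * (1 - ρ j) ≤ 1 - p j := by rw [hpj]; nlinarith
  have hd0 : 0 ≤ 1 - δ := by linarith
  have h2 : p j ^ 2 + (1 - 2 * p j) * ρ j = (p j - ρ j) ^ 2 + ρ j * (1 - ρ j) := by ring
  -- After the decomposition into squared bias and variance, the bound `1 - δ ≥ 11 / 12` compares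
  -- `ρ` with `p` from both ends. Each part is then at most `144 / 121` times `p j * (1 - p j)`, and
  -- twice this constant is below 4.
  have hr : 11 / 12 * ρ j ≤ p j := by nlinarith
  have hr' : 11 / 12 * (1 - ρ j) ≤ 1 - p j := by nlinarith
  have h3 : 121 / 144 * (ρ j * (1 - ρ j)) ≤ p j * (1 - p j) := by
    have := mul_le_mul hr hr' (by linarith) (by linarith)
    linarith
  have hp0 : 0 ≤ p j := by linarith
  have hp1 : p j ≤ 1 := by linarith
  have h4 : (p j - ρ j) ^ 2 ≤ 144 / 121 * (p j * (1 - p j)) := by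
    rcases le_total (p j) (ρ j) with h | h
    · nlinarith [mul_nonneg (by linarith : 0 ≤ 12 / 11 * p j - ρ j) (by linarith : 0 ≤ 1 - p j),
        mul_nonneg (by linarith : 0 ≤ ρ j - p j) (by linarith : (0:ℝ) ≤ 1 - ρ j),
        mul_nonneg (by linarith : 0 ≤ ρ j - p j) hp0]
    · nlinarith [mul_nonneg (by linarith : 0 ≤ p j - ρ j) hρ0,
        mul_nonneg (by linarith : 0 ≤ p j - ρ j) (by linarith : (0:ℝ) ≤ 1 - p j),
        mul_nonneg (by linarith : 0 ≤ 12 / 11 * (1 - p j) - (1 - ρ j)) hp0]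
  nlinarith [mul_nonneg hp0 (by linarith : 0 ≤ 1 - p j)]

lemma Real.one_le_log_mul {K : ℕ} (hK : 0 < K) {γ : ℝ} (hγ : 12 ≤ γ) : 1 ≤ Real.log (K * γ) := by
  have hK' : (1 : ℝ) ≤ K := by exact_mod_cast hK
  rw [Real.le_log_iff_exp_le (by positivity)]
  nlinarith [Real.exp_one_lt_d9]

/-- The value of the decision problem with mean graph `M`: some `p` has, against every loss vector
and every comparator, a gap of order `E_q[α] log (K γ) / γ`. -/
lemma graphLaws.exists_decision (hK : 2 ≤ K) (hq : q ∈ graphLaws M) {γ : ℝ} (hγ : 12 ≤ γ)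
    {f : Fin K → ℝ} (hf : ∀ j, f j ∈ Set.Icc (0 : ℝ) 1) {ε : ℝ} (hε : 0 < ε) :
    ∃ p ∈ stdSimplex ℝ (Fin K), ∀ (s : Fin K) (v : Fin K → ℝ),
      ∑ i, p i * v i - v s - γ / 8 * ∑ i, p i * ∑ j, M i j * (f j - v j) ^ 2
        ≤ 49 * (∑ E, q E * (E.indepNum : ℝ)) * Real.log (K * γ) / γ + ε := by
  classical
  have hK2 : (2 : ℝ) ≤ K := by exact_mod_cast hK
  have hK0 : 0 < K := by omega
  have : Nonempty (Fin K) := ⟨⟨0, hK0⟩⟩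
  have hγ0 : 0 < γ := by linarith
  set δ := 1 / γ with hδ
  have hδ0 : 0 < δ := by positivity
  have hδ12 : δ ≤ 1 / 12 := one_div_le_one_div_of_le (by norm_num) hγ
  set ρε := 1 / (K * γ) with hρε
  have hρε0 : 0 < ρε := by positivity
  -- The floor `1 / (K γ)`, together with `2 ≤ K`, keeps every `p j` strictly between 0 and 1. Hence
  -- all denominators are positive, and the floor is the `ε` producing `log (K γ)`.
  let S : Set (Fin K → ℝ) := {p | p ∈ stdSimplex ℝ (Fin K) ∧ ∀ j, ρε ≤ p j}
  have hSconv : Convex ℝ S := by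
    rintro x ⟨hx, hx'⟩ y ⟨hy, hy'⟩ a b ha hb hab
    refine ⟨convex_stdSimplex ℝ _ hx hy ha hb hab, fun j => ?_⟩
    simp only [Pi.add_apply, Pi.smul_apply, smul_eq_mul]
    calc ρε = a * ρε + b * ρε := by rw [← add_mul, hab, one_mul]
      _ ≤ _ := add_le_add (mul_le_mul_of_nonneg_left (hx' j) ha)
        (mul_le_mul_of_nonneg_left (hy' j) hb)
  have hS0 : ∀ p ∈ S, ∀ j, 0 < p j := fun p hp j => hρε0.trans_le (hp.2 j)
  have hS1 : ∀ p ∈ S, ∀ j, p j < 1 := by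
    intro p hp j
    obtain ⟨k, hk⟩ : ∃ k : Fin K, k ≠ j := by
      have : Nontrivial (Fin K) := Fin.nontrivial_iff_two_le.2 hK
      exact exists_ne j
    have h1 : p j + p k ≤ ∑ i, p i := by
      rw [← Finset.add_sum_erase _ _ (Finset.mem_univ j)]
      exact add_le_add le_rfl (Finset.single_le_sum (f := p) (fun i _ => hp.1.1 i)
        (Finset.mem_erase.2 ⟨hk, Finset.mem_univ k⟩))
    rw [hp.1.2] at h1
    linarith [hS0 p hp k]
  have hW : ∀ p ∈ S, ∀ j, 0 < ∑ i, p i * M i j := fun p hp =>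
    graphLaws.sum_mul_pos hq hp.1 (hS0 p hp) (hS1 p hp)
  -- This is the upper bound of `decision_gap_le`, in which the loss vector no longer appears, so
  -- that only finitely many convex functions remain.
  let Φ : Fin K → (Fin K → ℝ) → ℝ := fun s p =>
    ∑ i, p i * f i - f s
      + 2 / γ * ∑ j, (p j - Pi.single (M := fun _ => ℝ) s 1 j) ^ 2 / ∑ i, p i * M i j
  have hΦ : ∀ s, ConvexOn ℝ S (Φ s) := by
    refine fun s => ⟨hSconv, fun x hx y hy a b ha hb hab => ?_⟩
    have hlin : ∀ u : Fin K → ℝ, ∑ i, (a • x + b • y) i * u i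
        = a * ∑ i, x i * u i + b * ∑ i, y i * u i := by
      intro u
      rw [Finset.mul_sum, Finset.mul_sum, ← Finset.sum_add_distrib]
      exact Finset.sum_congr rfl fun i _ => by
        simp only [Pi.add_apply, Pi.smul_apply, smul_eq_mul]; ring
    have hquad : ∑ j, ((a • x + b • y) j - Pi.single (M := fun _ => ℝ) s 1 j) ^ 2
          / ∑ i, (a • x + b • y) i * M i j
        ≤ a * ∑ j, (x j - Pi.single (M := fun _ => ℝ) s 1 j) ^ 2 / ∑ i, x i * M i j
          + b * ∑ j, (y j - Pi.single (M := fun _ => ℝ) s 1 j) ^ 2 / ∑ i, y i * M i j := by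
      rw [Finset.mul_sum, Finset.mul_sum, ← Finset.sum_add_distrib]
      refine Finset.sum_le_sum fun j _ => ?_
      rw [hlin fun i => M i j]
      refine le_trans (le_of_eq ?_) (sq_div_convex (hW x hx j) (hW y hy j) ha hb hab)
      congr 2
      simp only [Pi.add_apply, Pi.smul_apply, smul_eq_mul]
      linear_combination Pi.single (M := fun _ => ℝ) s 1 j * hab
    have h2γ : 0 ≤ 2 / γ := by positivity
    simp only [Φ, smul_eq_mul]
    rw [hlin f]
    have h5 := mul_le_mul_of_nonneg_left hquad h2γ
    have h6 : f s = a * f s + b * f s := by rw [← add_mul, hab, one_mul]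
    linarith
  have hα := graphLaws.one_le_sum_indepNum hK0 hq
  set α := ∑ E, q E * (E.indepNum : ℝ) with hαdef
  have hL := Real.one_le_log_mul hK0 hγ
  have hmix : ∀ ρ ∈ stdSimplex ℝ (Fin K), ∃ p ∈ S,
      ∑ s, ρ s * Φ s p ≤ 49 * α * Real.log (K * γ) / γ := by
    intro ρ hρ
    have hKinv1 : 1 / (K : ℝ) ≤ 1 := by rw [div_le_one (by positivity)]; linarith
    let p : Fin K → ℝ := fun j => (1 - δ) * ρ j + δ * (1 / K)
    have hpS : p ∈ S := by
      refine ⟨⟨fun j => ?_, ?_⟩, fun j => ?_⟩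
      · have := hρ.1 j
        have h1 : 0 ≤ 1 - δ := by linarith
        simp only [p]; positivity
      · simp only [p]
        rw [Finset.sum_add_distrib, ← Finset.mul_sum, hρ.2, Finset.sum_const, Finset.card_univ,
          Fintype.card_fin, nsmul_eq_mul]
        field_simp
        ring
      · have h1 : 0 ≤ (1 - δ) * ρ j := mul_nonneg (by linarith) (hρ.1 j)
        have h2 : ρε = δ * (1 / K) := by rw [hρε, hδ]; field_simp
        simp only [p]; linarith
    refine ⟨p, hpS, ?_⟩
    have hlin : ∑ i, p i * f i - ∑ s, ρ s * f s ≤ δ := by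
      rw [← Finset.sum_sub_distrib]
      calc ∑ i, (p i * f i - ρ i * f i) ≤ ∑ _i : Fin K, δ * (1 / K) := by
            refine Finset.sum_le_sum fun i _ => ?_
            have h1 := hρ.1 i
            have h2 := (hf i).1
            have h3 := (hf i).2
            have h4 : 0 ≤ δ * ρ i * f i := by positivity
            have h5 : 0 ≤ δ * (1 / K) * (1 - f i) :=
              mul_nonneg (by positivity) (by linarith)
            simp only [p]; linarith
        _ = δ := by
            rw [Finset.sum_const, Finset.card_univ, Fintype.card_fin, nsmul_eq_mul]
            field_simp
    have hvar : ∑ s, ρ s * ∑ j, (p j - Pi.single (M := fun _ => ℝ) s 1 j) ^ 2 / ∑ i, p i * M i j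
        ≤ 4 * (3 * α * (1 + Real.log (1 / ρε))) := by
      calc ∑ s, ρ s * ∑ j, (p j - Pi.single (M := fun _ => ℝ) s 1 j) ^ 2 / ∑ i, p i * M i j
          = ∑ j, (∑ s, ρ s * (p j - Pi.single (M := fun _ => ℝ) s 1 j) ^ 2)
              / ∑ i, p i * M i j := by
            simp_rw [Finset.mul_sum, Finset.sum_div]
            rw [Finset.sum_comm]
            exact Finset.sum_congr rfl fun j _ => Finset.sum_congr rfl fun s _ => by ring
        _ ≤ ∑ j, 4 * (p j * (1 - p j)) / ∑ i, p i * M i j := by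
            refine Finset.sum_le_sum fun j _ => ?_
            exact div_le_div_of_nonneg_right (sum_mul_sq_sub_single_le hρ hδ0.le hδ12
              (by positivity) hKinv1 (fun _ => rfl) j) (hW p hpS j).le
        _ = 4 * ∑ j, p j * (1 - p j) / ∑ i, p i * M i j := by
            rw [Finset.mul_sum]
            exact Finset.sum_congr rfl fun j _ => by ring
        _ ≤ _ := mul_le_mul_of_nonneg_left
            (graphLaws.sum_div_le hq hpS.1 hρε0 hpS.2 (hS1 p hpS)) (by norm_num)
    have hlog : Real.log (1 / ρε) = Real.log (K * γ) := by rw [hρε, one_div_one_div]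
    rw [hlog] at hvar
    have hexp : ∑ s, ρ s * Φ s p = (∑ i, p i * f i - ∑ s, ρ s * f s)
        + 2 / γ * ∑ s, ρ s * ∑ j, (p j - Pi.single (M := fun _ => ℝ) s 1 j) ^ 2
            / ∑ i, p i * M i j := by
      have h1 : ∑ i, p i * f i = ∑ s, ρ s * ∑ i, p i * f i := by
        rw [← Finset.sum_mul, hρ.2, one_mul]
      rw [h1, Finset.mul_sum _ _ (2 / γ), ← Finset.sum_sub_distrib, ← Finset.sum_add_distrib]
      exact Finset.sum_congr rfl fun s _ => by simp only [Φ]; ring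
    rw [hexp]
    -- Since `1 ≤ log (K γ)`, the variance part gives `48 = 2 * 24`; together with the exploration
    -- cost `δ ≤ α log (K γ) / γ` this makes 49.
    have h7 : 2 / γ * (4 * (3 * α * (1 + Real.log (K * γ))))
        ≤ 2 / γ * (24 * α * Real.log (K * γ)) := by
      refine mul_le_mul_of_nonneg_left ?_ (by positivity)
      nlinarith
    have h8 : δ ≤ α * Real.log (K * γ) / γ := by
      rw [hδ]
      exact div_le_div_of_nonneg_right (by nlinarith) hγ0.le
    have h9 : 49 * α * Real.log (K * γ) / γ
        = α * Real.log (K * γ) / γ + 2 / γ * (24 * α * Real.log (K * γ)) := by ring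
    rw [h9]
    have h10 := mul_le_mul_of_nonneg_left hvar (by positivity : 0 ≤ 2 / γ)
    linarith
  obtain ⟨p, hp, hle⟩ := exists_forall_le_add_of_forall_mixture hΦ hmix hε
  refine ⟨p, hp.1, fun s v => ?_⟩
  have hswap : ∑ i, p i * ∑ j, M i j * (f j - v j) ^ 2
      = ∑ j, (∑ i, p i * M i j) * (f j - v j) ^ 2 := by
    simp_rw [Finset.mul_sum, Finset.sum_mul]
    rw [Finset.sum_comm]
    exact Finset.sum_congr rfl fun j _ => Finset.sum_congr rfl fun i _ => by ring
  rw [hswap]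
  exact (decision_gap_le hγ0 (hW p hp) s v).trans (hle s)

end Decision

/-! ### One round of the interaction, conditionally on the past -/

section Round

variable {K : ℕ} {X : Type u}

/-! ### Bounds and measurability for the expected independence number. -/

lemma bddBelow_indepNum_image (M : Fin K → Fin K → ℝ) :
    BddBelow ((fun q : FeedbackGraph K → ℝ => ∑ E, q E * (E.indepNum : ℝ)) '' graphLaws M) := by
  refine ⟨0, ?_⟩
  rintro _ ⟨q, hq, rfl⟩
  exact Finset.sum_nonneg fun E _ => mul_nonneg (hq.1.1 E) (Nat.cast_nonneg _)

lemma one_le_expIndepNum (hK : 0 < K) {g : X → Fin K → Fin K → ℝ} {x : X}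
    (h : (graphLaws (g x)).Nonempty) : 1 ≤ expIndepNum g x := by
  refine le_csInf (h.image _) ?_
  rintro _ ⟨q, hq, rfl⟩
  exact graphLaws.one_le_sum_indepNum hK hq

lemma expIndepNum_nonneg (g : X → Fin K → Fin K → ℝ) (x : X) : 0 ≤ expIndepNum g x := by
  refine Real.sInf_nonneg ?_
  rintro _ ⟨q, hq, rfl⟩
  exact Finset.sum_nonneg fun E _ => mul_nonneg (hq.1.1 E) (Nat.cast_nonneg _)

lemma expIndepNum_le (g : X → Fin K → Fin K → ℝ) (x : X) : expIndepNum g x ≤ K := by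
  rcases (graphLaws (g x)).eq_empty_or_nonempty with h | ⟨q, hq⟩
  · simp [expIndepNum, h]
  · exact (csInf_le (bddBelow_indepNum_image _) ⟨q, hq, rfl⟩).trans
      (graphLaws.sum_indepNum_le hq)

lemma isCompact_supported_laws (c : ℝ) :
    IsCompact {q : FeedbackGraph K → ℝ | q ∈ stdSimplex ℝ (FeedbackGraph K) ∧
      (∀ E, q E ≠ 0 → E.StronglyObservable) ∧ ∑ E, q E * (E.indepNum : ℝ) ≤ c} := by
  refine (isCompact_stdSimplex ℝ (FeedbackGraph K)).inter_right (IsClosed.inter ?_ ?_)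
  · have : {q : FeedbackGraph K → ℝ | ∀ E, q E ≠ 0 → E.StronglyObservable}
        = ⋂ E : FeedbackGraph K, {q | ¬ E.StronglyObservable → q E = 0} := by
      ext q
      simp only [Set.mem_ofPred_eq, Set.mem_iInter]
      exact forall_congr' fun E => not_imp_comm
    change IsClosed {q : FeedbackGraph K → ℝ | ∀ E, q E ≠ 0 → E.StronglyObservable}
    rw [this]
    refine isClosed_iInter fun E => ?_
    by_cases h : E.StronglyObservable
    · simp [h]
    · simpa [h] using isClosed_eq (continuous_apply E) continuous_const
  · have : Continuous fun q : FeedbackGraph K → ℝ => ∑ E, q E * (E.indepNum : ℝ) := by fun_prop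
    exact isClosed_le this continuous_const

/-- A sublevel set is, on matrices that are the mean of some law, the continuous image of a compact
set of laws. As `expIndepNum g x` depends only on the matrix `g x`, this form composes with `gs
(x_t)` without any measurability assumption on `gs`. -/
lemma measurable_expIndepNum_id :
    Measurable (expIndepNum (fun M : Fin K → Fin K → ℝ => M)) := by
  let mean : (FeedbackGraph K → ℝ) → Fin K → Fin K → ℝ := fun q i j => ∑ E, q E * E.ind i j
  have hmean : Continuous mean := by unfold mean; fun_prop
  have himg : ∀ c : ℝ, MeasurableSet (mean '' {q : FeedbackGraph K → ℝ |
      q ∈ stdSimplex ℝ (FeedbackGraph K) ∧ (∀ E, q E ≠ 0 → E.StronglyObservable) ∧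
        ∑ E, q E * (E.indepNum : ℝ) ≤ c}) := fun c =>
    ((isCompact_supported_laws c).image hmean).measurableSet
  have hdom : ∀ M, (graphLaws M).Nonempty ↔ M ∈ mean '' {q : FeedbackGraph K → ℝ |
      q ∈ stdSimplex ℝ (FeedbackGraph K) ∧ (∀ E, q E ≠ 0 → E.StronglyObservable) ∧
        ∑ E, q E * (E.indepNum : ℝ) ≤ K} := by
    intro M
    constructor
    · rintro ⟨q, hq⟩
      exact ⟨q, ⟨hq.1, hq.2.1, graphLaws.sum_indepNum_le hq⟩,
        funext fun i => funext fun j => hq.2.2 i j⟩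
    · rintro ⟨q, hq, rfl⟩
      exact ⟨q, hq.1, hq.2.1, fun i j => rfl⟩
  have hatt : ∀ M (c : ℝ), (graphLaws M).Nonempty →
      (expIndepNum (fun M : Fin K → Fin K → ℝ => M) M ≤ c ↔ M ∈ mean '' {q : FeedbackGraph K → ℝ |
        q ∈ stdSimplex ℝ (FeedbackGraph K) ∧ (∀ E, q E ≠ 0 → E.StronglyObservable) ∧
          ∑ E, q E * (E.indepNum : ℝ) ≤ c}) := by
    intro M c hM
    constructor
    · intro hle
      -- Compactness makes the infimum attained, so that a sublevel set is an image and not merely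
      -- contained in the images for larger levels.
      have hcomp : IsCompact (graphLaws M) := by
        have : graphLaws M = {q : FeedbackGraph K → ℝ | q ∈ stdSimplex ℝ (FeedbackGraph K) ∧
            (∀ E, q E ≠ 0 → E.StronglyObservable) ∧ ∑ E, q E * (E.indepNum : ℝ) ≤ K}
              ∩ mean ⁻¹' {M} := by
          ext q
          constructor
          · exact fun hq => ⟨⟨hq.1, hq.2.1, graphLaws.sum_indepNum_le hq⟩,
              funext fun i => funext fun j => hq.2.2 i j⟩
          · exact fun hq => ⟨hq.1.1, hq.1.2.1, fun i j => congrFun (congrFun hq.2 i) j⟩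
        rw [this]
        exact (isCompact_supported_laws _).inter_right (isClosed_singleton.preimage hmean)
      obtain ⟨q, hq, hqe⟩ := hcomp.exists_sInf_image_eq hM
        (f := fun q : FeedbackGraph K → ℝ => ∑ E, q E * (E.indepNum : ℝ)) (by fun_prop)
      refine ⟨q, ⟨hq.1, hq.2.1, ?_⟩, funext fun i => funext fun j => hq.2.2 i j⟩
      exact hqe.ge.trans hle
    · rintro ⟨q, hq, rfl⟩
      exact (csInf_le (bddBelow_indepNum_image _) ⟨q, ⟨hq.1, hq.2.1, fun i j => rfl⟩, rfl⟩).trans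
        hq.2.2
  refine measurable_of_Iic fun c => ?_
  -- A matrix with no law has value `sInf ∅ = 0`, so the complement of the domain belongs to the
  -- sublevel set exactly when `0 ≤ c`.
  by_cases hc : 0 ≤ c
  · have : expIndepNum (fun M : Fin K → Fin K → ℝ => M) ⁻¹' Set.Iic c
        = (mean '' {q : FeedbackGraph K → ℝ | q ∈ stdSimplex ℝ (FeedbackGraph K) ∧
            (∀ E, q E ≠ 0 → E.StronglyObservable) ∧ ∑ E, q E * (E.indepNum : ℝ) ≤ K})ᶜ
          ∪ mean '' {q : FeedbackGraph K → ℝ | q ∈ stdSimplex ℝ (FeedbackGraph K) ∧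
            (∀ E, q E ≠ 0 → E.StronglyObservable) ∧ ∑ E, q E * (E.indepNum : ℝ) ≤ c} := by
      ext M
      rw [Set.mem_union, Set.mem_compl_iff, ← hdom, Set.mem_preimage, Set.mem_Iic]
      by_cases hM : (graphLaws M).Nonempty
      · simp only [hM, not_true_eq_false, false_or]
        exact hatt M c hM
      · have h0 : expIndepNum (fun M : Fin K → Fin K → ℝ => M) M = 0 := by
          rw [Set.not_nonempty_iff_eq_empty] at hM
          simp [expIndepNum, hM]
        simp [hM, h0, hc]
    rw [this]
    exact (himg K).compl.union (himg c)
  · have : expIndepNum (fun M : Fin K → Fin K → ℝ => M) ⁻¹' Set.Iic c = ∅ := by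
      ext M
      simp only [Set.mem_preimage, Set.mem_Iic, Set.mem_empty_iff_false, iff_false, not_le]
      exact (not_le.1 hc).trans_le (expIndepNum_nonneg _ _)
    rw [this]
    exact MeasurableSet.empty

/-! ### Exchanging the true and the estimated mean graph. -/

lemma le_two_mul_add_two_mul_sq_sqrt_sub {a b : ℝ} (ha : 0 ≤ a) (hb : 0 ≤ b) :
    a ≤ 2 * b + 2 * (√a - √b) ^ 2 := by
  nlinarith [Real.sq_sqrt ha, Real.sq_sqrt hb, sq_nonneg (√a - 2 * √b)]

lemma bddAbove_dec_range {γ : ℝ} (hγ : 0 ≤ γ) {p : Fin K → ℝ} (hp : p ∈ stdSimplex ℝ (Fin K))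
    {f : X → Fin K → ℝ} {g : X → Fin K → Fin K → ℝ} {x : X} (hg : ∀ i j, 0 ≤ g x i j) :
    BddAbove (Set.range fun s : Fin K × {v : Fin K → ℝ // ∀ j, v j ∈ Set.Icc (0 : ℝ) 1} =>
      ∑ i, p i * s.2.1 i - s.2.1 s.1
        - γ / 4 * ∑ i, p i * ∑ j, g x i j * (f x j - s.2.1 j) ^ 2) := by
  refine ⟨1, ?_⟩
  rintro _ ⟨⟨s, v, hv⟩, rfl⟩
  have h1 : ∑ i, p i * v i ≤ 1 := by
    rw [← hp.2]
    exact Finset.sum_le_sum fun i _ => mul_le_of_le_one_right (hp.1 i) (hv i).2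
  have h2 : 0 ≤ γ / 4 * ∑ i, p i * ∑ j, g x i j * (f x j - v j) ^ 2 :=
    mul_nonneg (by positivity) (Finset.sum_nonneg fun i _ => mul_nonneg (hp.1 i)
      (Finset.sum_nonneg fun j _ => mul_nonneg (hg i j) (sq_nonneg _)))
  have h3 := (hv s).1
  simp only
  linarith

/-- Replacing a mean graph `a` by `b` in the observation term costs a Hellinger-type distance. -/
lemma sum_mul_sq_le_add_hellinger {p : Fin K → ℝ} (hp : p ∈ stdSimplex ℝ (Fin K))
    {a b : Fin K → Fin K → ℝ} (ha : ∀ i j, 0 ≤ a i j) (hb : ∀ i j, 0 ≤ b i j) {y v : Fin K → ℝ}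
    (hy : ∀ j, y j ∈ Set.Icc (0 : ℝ) 1) (hv : ∀ j, v j ∈ Set.Icc (0 : ℝ) 1) :
    ∑ i, p i * ∑ j, a i j * (y j - v j) ^ 2
      ≤ 2 * ∑ i, p i * ∑ j, b i j * (y j - v j) ^ 2
        + 2 * ∑ i, ∑ j, (√(a i j) - √(b i j)) ^ 2 := by
  rw [Finset.mul_sum, Finset.mul_sum, ← Finset.sum_add_distrib]
  refine Finset.sum_le_sum fun i _ => ?_
  have hp1 : p i ≤ 1 := by
    rw [← hp.2]; exact Finset.single_le_sum (fun i _ => hp.1 i) (Finset.mem_univ i)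
  have hD : 0 ≤ ∑ j, (√(a i j) - √(b i j)) ^ 2 := Finset.sum_nonneg fun j _ => sq_nonneg _
  have h1 : ∑ j, a i j * (y j - v j) ^ 2
      ≤ 2 * ∑ j, b i j * (y j - v j) ^ 2 + 2 * ∑ j, (√(a i j) - √(b i j)) ^ 2 := by
    rw [Finset.mul_sum, Finset.mul_sum, ← Finset.sum_add_distrib]
    refine Finset.sum_le_sum fun j _ => ?_
    have h2 := le_two_mul_add_two_mul_sq_sqrt_sub (ha i j) (hb i j)
    have h3 : (y j - v j) ^ 2 ≤ 1 := by
      have := hy j; have := hv j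
      simp only [Set.mem_Icc] at *
      exact sq_le_one_iff_abs_le_one _ |>.2 (abs_le.2 ⟨by linarith, by linarith⟩)
    have h4 := mul_le_mul_of_nonneg_right h2 (sq_nonneg (y j - v j))
    have h5 := mul_le_mul_of_nonneg_left h3 (sq_nonneg (√(a i j) - √(b i j)))
    linarith
  have h6 := mul_le_mul_of_nonneg_left h1 (hp.1 i)
  nlinarith [mul_le_mul_of_nonneg_right hp1 hD]

lemma gap_le_dec {γ : ℝ} (hγ : 0 ≤ γ) {p : Fin K → ℝ} (hp : p ∈ stdSimplex ℝ (Fin K))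
    {f : X → Fin K → ℝ} {g : X → Fin K → Fin K → ℝ} {x : X} (hg : ∀ i j, 0 ≤ g x i j)
    {v : Fin K → ℝ} (hv : ∀ j, v j ∈ Set.Icc (0 : ℝ) 1) (s : Fin K) :
    ∑ i, p i * v i - v s
      ≤ dec γ p f g x + γ / 4 * ∑ i, p i * ∑ j, g x i j * (f x j - v j) ^ 2 := by
  have := le_ciSup (bddAbove_dec_range hγ hp (f := f) hg) (s, ⟨v, hv⟩)
  simp only at this
  unfold dec
  linarith

/-- The value of the decision problem with estimated mean graph `g`, in terms of the true mean
graph `gs`. -/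
lemma dec_argmin_le (hK : 2 ≤ K) {γ : ℝ} (hγ : 12 ≤ γ) {f : X → Fin K → ℝ}
    {g gs : X → Fin K → Fin K → ℝ} {x : X} (hf : ∀ j, f x j ∈ Set.Icc (0 : ℝ) 1)
    (hg : ∀ i j, 0 ≤ g x i j) (hgs : (graphLaws (gs x)).Nonempty) {p : Fin K → ℝ}
    (hmin : ∀ p' ∈ stdSimplex ℝ (Fin K), dec γ p f g x ≤ dec γ p' f g x) :
    dec γ p f g x ≤ 49 * Real.log (K * γ) / γ * expIndepNum gs x
      + γ / 4 * ∑ i, ∑ j, (√(gs x i j) - √(g x i j)) ^ 2 := by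
  have hγ0 : 0 < γ := by linarith
  have hL := Real.one_le_log_mul (by omega : 0 < K) hγ
  set D := ∑ i, ∑ j, (√(gs x i j) - √(g x i j)) ^ 2 with hD
  have hgs0 : ∀ i j, 0 ≤ gs x i j := fun i j => (graphLaws.mem_Icc hgs.some_mem i j).1
  have : Nonempty (Fin K) := ⟨⟨0, by omega⟩⟩
  -- The near-optimal `p'` is built for the true graph with coefficient `γ / 8`; exchanging graphs
  -- doubles it to the `γ / 4` in `dec` and adds `γ / 4 * D`. Only afterwards is the infimum over
  -- `q` taken, as the left side does not depend on `q`.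
  have key : ∀ q ∈ graphLaws (gs x), dec γ p f g x - γ / 4 * D
      ≤ 49 * Real.log (K * γ) / γ * ∑ E, q E * (E.indepNum : ℝ) := by
    intro q hq
    refine le_of_forall_pos_le_add fun ε hε => ?_
    obtain ⟨p', hp', hle⟩ := graphLaws.exists_decision hK hq hγ hf hε
    have h1 : dec γ p' f g x ≤ 49 * Real.log (K * γ) / γ * ∑ E, q E * (E.indepNum : ℝ) + ε
        + γ / 4 * D := by
      have : Nonempty {v : Fin K → ℝ // ∀ j, v j ∈ Set.Icc (0 : ℝ) 1} := ⟨⟨f x, hf⟩⟩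
      refine ciSup_le fun ⟨s, v, hv⟩ => ?_
      have h2 := hle s v
      have h3 := sum_mul_sq_le_add_hellinger hp' hgs0 hg hf hv
      have h4 := mul_le_mul_of_nonneg_left h3 (by positivity : 0 ≤ γ / 8)
      have h5 : 49 * (∑ E, q E * (E.indepNum : ℝ)) * Real.log (K * γ) / γ
        = 49 * Real.log (K * γ) / γ * ∑ E, q E * (E.indepNum : ℝ) := by ring
      simp only
      linarith
    linarith [hmin p' hp']
  have hc : 0 < 49 * Real.log (K * γ) / γ := by positivity
  have h6 : (dec γ p f g x - γ / 4 * D) / (49 * Real.log (K * γ) / γ) ≤ expIndepNum gs x := by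
    refine le_csInf (hgs.image _) ?_
    rintro _ ⟨q, hq, rfl⟩
    rw [div_le_iff₀ hc]
    exact (key q hq).trans_eq (mul_comm _ _)
  rw [div_le_iff₀ hc] at h6
  linarith

/-- The conditional regret of one round. -/
lemma round_regret_le (hK : 2 ≤ K) {γ : ℝ} (hγ : 12 ≤ γ) {f fs : X → Fin K → ℝ}
    {g gs : X → Fin K → Fin K → ℝ} {x : X} (hf : ∀ j, f x j ∈ Set.Icc (0 : ℝ) 1)
    (hfs : ∀ j, fs x j ∈ Set.Icc (0 : ℝ) 1) (hg : ∀ i j, 0 ≤ g x i j)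
    (hgs : (graphLaws (gs x)).Nonempty) {p : Fin K → ℝ} (hp : p ∈ stdSimplex ℝ (Fin K))
    (hmin : ∀ p' ∈ stdSimplex ℝ (Fin K), dec γ p f g x ≤ dec γ p' f g x) :
    ∑ i, p i * fs x i - ⨅ i, fs x i ≤ 49 * Real.log (K * γ) / γ * expIndepNum gs x
      + 3 / 4 * γ * ∑ i, ∑ j, (√(gs x i j) - √(g x i j)) ^ 2
      + γ / 2 * ∑ i, ∑ j, p i * (gs x i j * (f x j - fs x j) ^ 2) := by
  have hγ0 : 0 < γ := by linarith
  have hgs0 : ∀ i j, 0 ≤ gs x i j := fun i j => (graphLaws.mem_Icc hgs.some_mem i j).1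
  have : Nonempty (Fin K) := ⟨⟨0, by omega⟩⟩
  obtain ⟨s, hs⟩ := exists_eq_ciInf_of_finite (f := fs x)
  rw [← hs]
  have h1 := gap_le_dec hγ0.le hp (f := f) hg hfs s
  have h2 := dec_argmin_le hK hγ hf hg hgs hmin
  -- This second exchange, now from `g` to `gs`, costs `γ / 2` times the distance; with the `γ / 4`
  -- from `dec_argmin_le` this makes `3 / 4 * γ`.
  have h3 := mul_le_mul_of_nonneg_left (sum_mul_sq_le_add_hellinger hp hg hgs0 hf hfs)
    (by positivity : 0 ≤ γ / 4)
  have h4 : ∑ i, ∑ j, (√(g x i j) - √(gs x i j)) ^ 2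
      = ∑ i, ∑ j, (√(gs x i j) - √(g x i j)) ^ 2 :=
    Finset.sum_congr rfl fun i _ => Finset.sum_congr rfl fun j _ => by ring
  have h5 : ∑ i, ∑ j, p i * (gs x i j * (f x j - fs x j) ^ 2)
      = ∑ i, p i * ∑ j, gs x i j * (f x j - fs x j) ^ 2 :=
    Finset.sum_congr rfl fun i _ => by rw [Finset.mul_sum]
  rw [h4] at h3
  rw [h5]
  linarith

end Round

/-! ### The log loss -/

lemma measurable_logInv : Measurable logInv :=
  Measurable.ite (measurableSet_singleton 0) measurable_const (by fun_prop)

/-- The condition excludes the one infinite case; when `a = b = 0`, both `0 * ∞` and the real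
expression vanish. -/
lemma ofReal_mul_logInv {a b : ℝ} (ha : 0 ≤ a) (hab : b = 0 → a = 0) :
    ENNReal.ofReal a * logInv b = ENNReal.ofReal (a * Real.log (1 / b)) := by
  unfold logInv
  split_ifs with h
  · simp [hab h]
  · rw [ENNReal.ofReal_mul ha]

/-- This is `log x ≤ x - 1` at `x = √(b / a)`, multiplied by `2 a`. Its instances for success and
failure add up to the comparison of divergence and Hellinger distance. -/
lemma mul_log_one_div_add_le {a b : ℝ} (ha : 0 ≤ a) (hb : 0 ≤ b) (hab : b = 0 → a = 0) :
    a * Real.log (1 / a) + 2 * (a - √a * √b) ≤ a * Real.log (1 / b) := by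
  rcases ha.eq_or_lt with rfl | ha'
  · simp
  have hb' : 0 < b := hb.lt_of_ne fun h => ha'.ne' (hab h.symm)
  have h1 := Real.log_le_sub_one_of_pos (x := √b / √a) (by positivity)
  rw [Real.log_div (by positivity) (by positivity), Real.log_sqrt hb, Real.log_sqrt ha] at h1
  have h2 := mul_le_mul_of_nonneg_left h1 ha
  have h3 : a * (√b / √a - 1) = √a * √b - a := by
    have h4 := Real.mul_self_sqrt ha
    have : √a ≠ 0 := by positivity
    calc a * (√b / √a - 1) = √a * √a * (√b / √a) - a := by rw [h4]; ring
      _ = √a * √b - a := by field_simp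
  rw [h3] at h2
  rw [one_div, one_div, Real.log_inv, Real.log_inv]
  linarith

lemma mul_log_one_div_mem_Icc {a : ℝ} (ha : a ∈ Set.Icc (0 : ℝ) 1) :
    a * Real.log (1 / a) ∈ Set.Icc (0 : ℝ) 1 := by
  rcases ha.1.eq_or_lt with h0 | h0
  · simp [← h0]
  refine ⟨mul_nonneg ha.1 (Real.log_nonneg ((one_le_div h0).2 ha.2)), ?_⟩
  have := mul_le_mul_of_nonneg_left (Real.log_le_sub_one_of_pos (one_div_pos.2 h0)) ha.1
  have h1 : a * (1 / a - 1) = 1 - a := by field_simp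
  linarith [ha.1]

lemma one_sub_mem_Icc {a : ℝ} (ha : a ∈ Set.Icc (0 : ℝ) 1) : 1 - a ∈ Set.Icc (0 : ℝ) 1 :=
  ⟨by linarith [ha.2], by linarith [ha.1]⟩

lemma logLoss_self_le {a : ℝ} (ha : a ∈ Set.Icc (0 : ℝ) 1) : logLoss a a ≤ 2 := by
  rw [logLoss, ofReal_mul_logInv ha.1 id, ofReal_mul_logInv (one_sub_mem_Icc ha).1 id,
    ← one_add_one_eq_two]
  refine add_le_add ?_ ?_ <;> rw [← ENNReal.ofReal_one]
  · exact ENNReal.ofReal_le_ofReal (mul_log_one_div_mem_Icc ha).2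
  · exact ENNReal.ofReal_le_ofReal (mul_log_one_div_mem_Icc (one_sub_mem_Icc ha)).2

/-- The Kullback–Leibler divergence of two Bernoulli distributions is at least their squared
Hellinger distance. -/
lemma logLoss_self_add_hellinger_le {a b : ℝ} (ha : a ∈ Set.Icc (0 : ℝ) 1)
    (hb : b ∈ Set.Icc (0 : ℝ) 1) :
    logLoss a a + ENNReal.ofReal ((√a - √b) ^ 2) ≤ logLoss b a := by
  have ha' := one_sub_mem_Icc ha
  have hb' := one_sub_mem_Icc hb
  by_cases h0 : b = 0 → a = 0
  · by_cases h1 : 1 - b = 0 → 1 - a = 0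
    · rw [logLoss, logLoss, ofReal_mul_logInv ha.1 id, ofReal_mul_logInv ha'.1 id,
        ofReal_mul_logInv ha.1 h0, ofReal_mul_logInv ha'.1 h1]
      have hn : ∀ {c d : ℝ}, 0 ≤ c → d ∈ Set.Icc (0 : ℝ) 1 → 0 ≤ c * Real.log (1 / d) := by
        intro c d hc hd
        rcases hd.1.eq_or_lt with h | h
        · simp [← h]
        · exact mul_nonneg hc (Real.log_nonneg ((one_le_div h).2 hd.2))
      have n1 := hn ha.1 ha
      have n2 := hn ha'.1 ha'
      rw [← ENNReal.ofReal_add n1 n2, ← ENNReal.ofReal_add (by positivity) (sq_nonneg _),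
        ← ENNReal.ofReal_add (hn ha.1 hb) (hn ha'.1 hb')]
      refine ENNReal.ofReal_le_ofReal ?_
      -- The two lower bounds add up to `(√a - √b)² + (√(1 - a) - √(1 - b))²`, of which the second
      -- square is dropped.
      have k1 := mul_log_one_div_add_le ha.1 hb.1 h0
      have k2 := mul_log_one_div_add_le ha'.1 hb'.1 h1
      have s1 := Real.sq_sqrt ha.1
      have s2 := Real.sq_sqrt hb.1
      have s3 := Real.sq_sqrt ha'.1
      have s4 := Real.sq_sqrt hb'.1
      nlinarith [sq_nonneg (√(1 - a) - √(1 - b))]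
    · obtain ⟨h2, h3⟩ := Classical.not_imp.1 h1
      have : logLoss b a = ⊤ := by
        have h4 : ENNReal.ofReal (1 - a) ≠ 0 := by
          simpa using lt_of_le_of_ne ha'.1 (Ne.symm h3)
        rw [logLoss, logInv, logInv, if_pos h2, ENNReal.mul_top h4, add_top]
      rw [this]
      exact le_top
  · obtain ⟨h2, h3⟩ := Classical.not_imp.1 h0
    have : logLoss b a = ⊤ := by
      have h4 : ENNReal.ofReal a ≠ 0 := by
        simpa using lt_of_le_of_ne ha.1 (Ne.symm h3)
      rw [logLoss, logInv, if_pos h2, ENNReal.mul_top h4, top_add]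
    rw [this]
    exact le_top

/-! ### Pulling known factors out of conditional expectations -/

section PullOut

variable {Ω : Type v} {m mΩ : MeasurableSpace Ω} {μ : Measure Ω} [IsProbabilityMeasure μ]

lemma integral_mul_eq_of_condExp (hm : m ≤ mΩ) {b h Z : Ω → ℝ} (hb : Integrable b μ)
    (hh : μ[b | m] =ᵐ[μ] h) (hZ : AEStronglyMeasurable[m] Z μ) {C : ℝ}
    (hC : ∀ᵐ ω ∂μ, ‖Z ω‖ ≤ C) : ∫ ω, Z ω * b ω ∂μ = ∫ ω, Z ω * h ω ∂μ := by
  have hint : Integrable (Z * b) μ := hb.bdd_mul (hZ.mono hm) hC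
  have h1 := condExp_mul_of_aestronglyMeasurable_left hZ hint hb
  calc ∫ ω, Z ω * b ω ∂μ = ∫ ω, (μ[Z * b | m]) ω ∂μ := (integral_condExp hm).symm
    _ = ∫ ω, Z ω * h ω ∂μ := by
        refine integral_congr_ae ?_
        filter_upwards [h1, hh] with ω h1 h2
        rw [h1, Pi.mul_apply, h2]

/-- The factor `Z` may be unbounded or infinite, as `logInv` is, so integrability of the product is
not available. Instead, the measures with densities `b` and `μ[b | m]` agree on `m`-measurable sets,
hence integrate every `m`-measurable `Z` equally. -/
lemma lintegral_mul_ofReal_eq_of_condExp (hm : m ≤ mΩ) {b h : Ω → ℝ} (hbm : Measurable b)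
    (hb : Integrable b μ) (hb0 : ∀ ω, 0 ≤ b ω) (hh : μ[b | m] =ᵐ[μ] h) {Z : Ω → ℝ≥0∞}
    (hZ : Measurable[m] Z) :
    ∫⁻ ω, Z ω * ENNReal.ofReal (b ω) ∂μ = ∫⁻ ω, Z ω * ENNReal.ofReal (h ω) ∂μ := by
  have hc : Measurable (μ[b | m]) := (stronglyMeasurable_condExp.mono hm).measurable
  have hZ' : Measurable Z := hZ.mono hm le_rfl
  have hc0 : 0 ≤ᵐ[μ] μ[b | m] := condExp_nonneg (ae_of_all _ hb0)
  have htrim : (μ.withDensity fun ω => ENNReal.ofReal (b ω)).trim hm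
      = (μ.withDensity fun ω => ENNReal.ofReal ((μ[b | m]) ω)).trim hm := by
    refine @Measure.ext _ m _ _ fun s hs => ?_
    rw [trim_measurableSet_eq hm hs, trim_measurableSet_eq hm hs,
      withDensity_apply _ (hm s hs), withDensity_apply _ (hm s hs),
      ← ofReal_integral_eq_lintegral_ofReal hb.integrableOn (ae_of_all _ hb0),
      ← ofReal_integral_eq_lintegral_ofReal integrable_condExp.integrableOn
        (ae_restrict_of_ae hc0), setIntegral_condExp hm hb hs]
  have h1 : ∀ k : Ω → ℝ, Measurable k → ∫⁻ ω, Z ω * ENNReal.ofReal (k ω) ∂μ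
      = ∫⁻ ω, Z ω ∂((μ.withDensity fun ω => ENNReal.ofReal (k ω)).trim hm) := by
    intro k hk
    rw [lintegral_trim hm hZ, lintegral_withDensity_eq_lintegral_mul _ (by fun_prop) hZ']
    exact lintegral_congr fun ω => mul_comm _ _
  rw [h1 b hbm, htrim, ← h1 _ hc]
  refine lintegral_congr_ae ?_
  filter_upwards [hh] with ω hω
  rw [hω]

/-- The log loss is affine in the label, with coefficients determined by the prediction, so the
label can be replaced by its conditional mean. -/
lemma lintegral_logLoss_eq_of_condExp (hm : m ≤ mΩ) {b h u : Ω → ℝ} (hbm : Measurable b)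
    (hb01 : ∀ ω, b ω ∈ Set.Icc (0 : ℝ) 1) (hh : μ[b | m] =ᵐ[μ] h) (hu : Measurable[m] u) :
    ∫⁻ ω, logLoss (u ω) (b ω) ∂μ = ∫⁻ ω, logLoss (u ω) (h ω) ∂μ := by
  have hb : Integrable b μ := Integrable.of_bound hbm.aestronglyMeasurable 1
    (ae_of_all _ fun ω => by
    rw [Real.norm_of_nonneg (hb01 ω).1]; exact (hb01 ω).2)
  have hh' : μ[fun ω => 1 - b ω | m] =ᵐ[μ] fun ω => 1 - h ω := by
    have h1 := condExp_sub (integrable_const (1 : ℝ)) hb m (μ := μ)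
    rw [condExp_const hm] at h1
    refine h1.trans ?_
    filter_upwards [hh] with ω hω
    rw [Pi.sub_apply, hω]
  have hum : Measurable u := hu.mono hm le_rfl
  have hmeas : AEMeasurable h μ :=
    ((stronglyMeasurable_condExp.mono hm).aestronglyMeasurable.congr hh).aemeasurable
  have l1 := lintegral_mul_ofReal_eq_of_condExp hm hbm hb (fun ω => (hb01 ω).1) hh
    (measurable_logInv.comp hu)
  have l2 := lintegral_mul_ofReal_eq_of_condExp hm (measurable_const.sub hbm)
    ((integrable_const (1 : ℝ)).sub hb) (fun ω => (one_sub_mem_Icc (hb01 ω)).1) hh'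
    (measurable_logInv.comp (hu.const_sub 1))
  have hsplit : ∀ k : Ω → ℝ, AEMeasurable k μ → ∫⁻ ω, logLoss (u ω) (k ω) ∂μ
      = ∫⁻ ω, logInv (u ω) * ENNReal.ofReal (k ω) ∂μ
        + ∫⁻ ω, logInv (1 - u ω) * ENNReal.ofReal (1 - k ω) ∂μ := by
    intro k hk
    refine Eq.trans ?_ (lintegral_add_left'
      ((measurable_logInv.comp hum).aemeasurable.mul hk.ennreal_ofReal) _)
    exact lintegral_congr fun ω => by
      rw [logLoss, mul_comm, mul_comm (logInv (1 - u ω))]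
      rfl
  rw [hsplit b hbm.aemeasurable, hsplit h hmeas]
  exact congrArg₂ (· + ·) l1 l2

end PullOut

lemma AEMeasurable.logLoss {Ω : Type v} [MeasurableSpace Ω] {μ : Measure Ω} {u w : Ω → ℝ}
    (hu : AEMeasurable u μ) (hw : AEMeasurable w μ) :
    AEMeasurable (fun ω => logLoss (u ω) (w ω)) μ := by
  unfold _root_.logLoss
  exact (hw.ennreal_ofReal.mul (measurable_logInv.comp_aemeasurable hu)).add
    ((hw.const_sub 1).ennreal_ofReal.mul (measurable_logInv.comp_aemeasurable (hu.const_sub 1)))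

lemma lintegral_sum_sum_sum {Ω : Type v} [MeasurableSpace Ω] {μ : Measure Ω} {K : ℕ} (s : Finset ℕ)
    {F : ℕ → Fin K → Fin K → Ω → ℝ≥0∞} (hF : ∀ t ∈ s, ∀ i j, AEMeasurable (F t i j) μ) :
    ∫⁻ ω, ∑ t ∈ s, ∑ i, ∑ j, F t i j ω ∂μ = ∑ t ∈ s, ∑ i, ∑ j, ∫⁻ ω, F t i j ω ∂μ := by
  rw [lintegral_finsetSum' _ fun t ht => Finset.aemeasurable_fun_sum _ fun i _ =>
    Finset.aemeasurable_fun_sum _ fun j _ => hF t ht i j]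
  refine Finset.sum_congr rfl fun t ht => ?_
  rw [lintegral_finsetSum' _ fun i _ => Finset.aemeasurable_fun_sum _ fun j _ => hF t ht i j]
  refine Finset.sum_congr rfl fun i _ => ?_
  rw [lintegral_finsetSum' _ fun j _ => hF t ht i j]

/-! ### Consequences of the interaction protocol -/

namespace Play

variable {K T : ℕ} {X : Type u} {Ω : Type v} [mΩ : MeasurableSpace Ω]
  {μ : Measure Ω} {ℋ : Filtration ℕ mΩ} {𝓕 : Set (X → Fin K → ℝ)}
  {𝓖 : Set (X → Fin K → Fin K → ℝ)} {fs : X → Fin K → ℝ} {gs : X → Fin K → Fin K → ℝ}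
  {regSq regLog γ : ℝ} {P : Play K X Ω} {t : ℕ}

lemma IsInteraction.measurable_of_graph [MeasurableSpace X] (hI : P.IsInteraction T ℋ) (ht : t < T)
    {β : Type*} [MeasurableSpace β] (φ : FeedbackGraph K → β) :
    Measurable fun ω => φ (P.graph t ω) :=
  (@measurable_from_top _ _ _ φ).comp ((hI.graph_meas t ht).mono (ℋ.le _) le_rfl)

lemma IsInteraction.measurable_loss [MeasurableSpace X] (hI : P.IsInteraction T ℋ) (ht : t < T) :
    Measurable (P.loss t) := (hI.loss_meas t ht).mono (ℋ.le _) le_rfl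

lemma IsInteraction.measurable_act [MeasurableSpace X] (hI : P.IsInteraction T ℋ) (ht : t < T) :
    Measurable (P.act t) := (hI.act_meas t ht).mono (ℋ.le _) le_rfl

lemma IsInteraction.measurable_actInd [MeasurableSpace X] (hI : P.IsInteraction T ℋ)
    (ht : t < T) (i : Fin K) :
    Measurable fun ω => if P.act t ω = i then (1 : ℝ) else 0 :=
  Measurable.ite (hI.measurable_act ht (measurableSet_singleton i)) measurable_const
    measurable_const

lemma IsInteraction.beforeAct_le [MeasurableSpace X] (hI : P.IsInteraction T ℋ) (ht : t < T) :
    P.beforeAct ℋ t ≤ mΩ := by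
  refine sup_le (sup_le (ℋ.le t) (measurable_iff_comap_le.1 (hI.measurable_loss ht))) ?_
  exact measurable_iff_comap_le.1 ((hI.graph_meas t ht).mono (ℋ.le _) le_rfl)

lemma le_beforeAct : ℋ t ≤ P.beforeAct ℋ t := le_sup_left.trans le_sup_left

lemma measurable_loss_beforeAct : Measurable[P.beforeAct ℋ t] (P.loss t) :=
  (comap_measurable (P.loss t)).mono (le_sup_right.trans le_sup_left) le_rfl

lemma measurable_of_graph_beforeAct {β : Type*} [MeasurableSpace β] (φ : FeedbackGraph K → β) :
    Measurable[P.beforeAct ℋ t] fun ω => φ (P.graph t ω) := by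
  have h : Measurable[P.beforeAct ℋ t, ⊤] (P.graph t) := by
    refine Measurable.mono (@comap_measurable _ _ ⊤ (P.graph t)) ?_ le_rfl
    exact le_sup_right
  exact (@measurable_from_top _ _ _ φ).comp h

lemma IsRealizable.fs_mem_Icc (hR : P.IsRealizable T ℋ μ 𝓕 𝓖 fs gs) (x : X) (i : Fin K) :
    fs x i ∈ Set.Icc (0 : ℝ) 1 := hR.class_loss fs hR.fs_mem x i

lemma IsRealizable.gs_mem_Icc (hR : P.IsRealizable T ℋ μ 𝓕 𝓖 fs gs) (x : X) (i j : Fin K) :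
    gs x i j ∈ Set.Icc (0 : ℝ) 1 := hR.class_graph gs hR.gs_mem x i j

lemma IsRealizable.lossEst_mem_Icc (hR : P.IsRealizable T ℋ μ 𝓕 𝓖 fs gs)
    (hS : P.SquareLossOracle T μ 𝓕 regSq) (ht : t < T) (ω : Ω) (x : X) (i : Fin K) :
    P.lossEst t ω x i ∈ Set.Icc (0 : ℝ) 1 := by
  have hconv : Convex ℝ {f : X → Fin K → ℝ | f x i ∈ Set.Icc (0 : ℝ) 1} :=
    (convex_Icc (0 : ℝ) 1).is_linear_preimage
      (f := fun f : X → Fin K → ℝ => f x i) ⟨fun _ _ => rfl, fun _ _ => rfl⟩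
  exact convexHull_min (fun f hf => hR.class_loss f hf x i) hconv (hS.mem_hull t ht ω)

lemma IsRealizable.graphEst_mem_Icc (hR : P.IsRealizable T ℋ μ 𝓕 𝓖 fs gs)
    (hG : P.LogLossOracle T μ 𝓖 regLog) (ht : t < T) (ω : Ω) (x : X) (i j : Fin K) :
    P.graphEst t ω x i j ∈ Set.Icc (0 : ℝ) 1 := by
  have hconv : Convex ℝ {g : X → Fin K → Fin K → ℝ | g x i j ∈ Set.Icc (0 : ℝ) 1} :=
    (convex_Icc (0 : ℝ) 1).is_linear_preimage
      (f := fun g : X → Fin K → Fin K → ℝ => g x i j) ⟨fun _ _ => rfl, fun _ _ => rfl⟩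
  exact convexHull_min (fun g hg => hR.class_graph g hg x i j) hconv (hG.mem_hull t ht ω)

/-- Nothing is assumed on the measurability of `fs` itself; along the contexts it is almost
everywhere a conditional expectation. -/
lemma IsRealizable.aestronglyMeasurable_fs (hR : P.IsRealizable T ℋ μ 𝓕 𝓖 fs gs) (ht : t < T)
    (i : Fin K) : AEStronglyMeasurable[ℋ t] (fun ω => fs (P.ctx t ω) i) μ :=
  stronglyMeasurable_condExp.aestronglyMeasurable.congr (hR.mean_loss t ht i)

lemma IsRealizable.aestronglyMeasurable_gs (hR : P.IsRealizable T ℋ μ 𝓕 𝓖 fs gs) (ht : t < T)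
    (i j : Fin K) : AEStronglyMeasurable[ℋ t] (fun ω => gs (P.ctx t ω) i j) μ :=
  stronglyMeasurable_condExp.aestronglyMeasurable.congr (hR.mean_graph t ht i j)

lemma IsRealizable.aemeasurable_expIndepNum (hR : P.IsRealizable T ℋ μ 𝓕 𝓖 fs gs)
    (ht : t < T) : AEMeasurable (fun ω => expIndepNum gs (P.ctx t ω)) μ := by
  have h : AEMeasurable (fun ω => gs (P.ctx t ω)) μ :=
    aemeasurable_pi_iff.2 fun i => aemeasurable_pi_iff.2 fun j =>
      ((hR.aestronglyMeasurable_gs ht i j).mono (ℋ.le t)).aemeasurable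
  exact measurable_expIndepNum_id.comp_aemeasurable h

variable [IsProbabilityMeasure μ]

/-- The conditional law of the feedback graph has mean `gs`. -/
lemma IsRealizable.graphLaws_nonempty [MeasurableSpace X] (hR : P.IsRealizable T ℋ μ 𝓕 𝓖 fs gs)
    (hI : P.IsInteraction T ℋ) (ht : t < T) :
    ∀ᵐ ω ∂μ, (graphLaws (gs (P.ctx t ω))).Nonempty := by
  classical
  -- The law is the vector of conditional probabilities of the finitely many graphs, so all almost
  -- sure identities hold simultaneously.
  let b : FeedbackGraph K → Ω → ℝ := fun E ω => if P.graph t ω = E then 1 else 0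
  have hbm : ∀ E, Measurable (b E) := fun E =>
    hI.measurable_of_graph ht fun G => if G = E then (1 : ℝ) else 0
  have hb : ∀ E, Integrable (b E) μ := fun E =>
    Integrable.of_bound (hbm E).aestronglyMeasurable 1 (ae_of_all _ fun ω => by
      simp only [b]; split_ifs <;> simp)
  have h0 : ∀ᵐ ω ∂μ, ∀ E, 0 ≤ (μ[b E | ℋ t]) ω := by
    refine ae_all_iff.2 fun E => condExp_nonneg (ae_of_all _ fun ω => ?_)
    simp only [b, Pi.zero_apply]; split_ifs <;> simp
  have hlin : ∀ c : FeedbackGraph K → ℝ, μ[fun ω => c (P.graph t ω) | ℋ t]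
      =ᵐ[μ] fun ω => ∑ E, (μ[b E | ℋ t]) ω * c E := by
    intro c
    have h1 : (fun ω => c (P.graph t ω)) = ∑ E, c E • b E := by
      ext ω
      simp [b, Finset.sum_apply]
    rw [h1]
    refine (condExp_finsetSum (fun E _ => (hb E).smul (c E)) (ℋ t)).trans ?_
    have h2 : ∀ᵐ ω ∂μ, ∀ E, (μ[c E • b E | ℋ t]) ω = c E * (μ[b E | ℋ t]) ω :=
      ae_all_iff.2 fun E => condExp_smul (c E) (b E) (ℋ t)
    filter_upwards [h2] with ω h2
    rw [Finset.sum_apply]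
    exact Finset.sum_congr rfl fun E _ => by rw [h2, mul_comm]
  have h1 : ∀ᵐ ω ∂μ, ∑ E, (μ[b E | ℋ t]) ω = 1 := by
    have := hlin fun _ => 1
    rw [condExp_const (ℋ.le t)] at this
    filter_upwards [this] with ω hω
    simpa using hω.symm
  have hso : ∀ᵐ ω ∂μ, ∀ E : FeedbackGraph K, (μ[b E | ℋ t]) ω ≠ 0 → E.StronglyObservable := by
    refine ae_all_iff.2 fun E => ?_
    by_cases hE : E.StronglyObservable
    · exact ae_of_all _ fun _ _ => hE
    · have hz : b E = 0 := by
        ext ω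
        simp only [b, Pi.zero_apply]
        rw [if_neg]
        rintro rfl
        exact hE (hI.graph_obs t ht ω)
      rw [hz, condExp_zero]
      exact ae_of_all _ fun _ h => absurd rfl h
  have hm : ∀ᵐ ω ∂μ, ∀ i j, ∑ E, (μ[b E | ℋ t]) ω * E.ind i j = gs (P.ctx t ω) i j := by
    refine ae_all_iff.2 fun i => ae_all_iff.2 fun j => ?_
    filter_upwards [hlin fun E => E.ind i j, hR.mean_graph t ht i j] with ω h2 h3
    rw [← h2, h3]
  filter_upwards [h0, h1, hso, hm] with ω h0 h1 hso hm
  exact ⟨fun E => (μ[b E | ℋ t]) ω, ⟨h0, h1⟩, hso, hm⟩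

lemma IsRealizable.integrable_expIndepNum (hR : P.IsRealizable T ℋ μ 𝓕 𝓖 fs gs)
    (ht : t < T) : Integrable (fun ω => expIndepNum gs (P.ctx t ω)) μ :=
  Integrable.of_bound (hR.aemeasurable_expIndepNum ht).aestronglyMeasurable K
    (ae_of_all _ fun ω => by
      rw [Real.norm_of_nonneg (expIndepNum_nonneg _ _)]
      exact expIndepNum_le _ _)

lemma IsRealizable.sumIndep_eq (hR : P.IsRealizable T ℋ μ 𝓕 𝓖 fs gs) :
    P.sumIndep T μ gs = ∑ t ∈ range T, ∫ ω, expIndepNum gs (P.ctx t ω) ∂μ :=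
  integral_finsetSum _ fun _ ht => hR.integrable_expIndepNum (Finset.mem_range.1 ht)

/-- Each independence number is at least 1, so `A` dominates the trivial regret bound `T`. -/
lemma IsRealizable.le_sumIndep [MeasurableSpace X] (hR : P.IsRealizable T ℋ μ 𝓕 𝓖 fs gs)
    (hI : P.IsInteraction T ℋ) (hK : 0 < K) : (T : ℝ) ≤ P.sumIndep T μ gs := by
  rw [hR.sumIndep_eq]
  calc (T : ℝ) = ∑ t ∈ range T, (1 : ℝ) := by simp
    _ ≤ _ := by
      refine Finset.sum_le_sum fun t ht => ?_
      have ht := Finset.mem_range.1 ht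
      have h1 : ∫ _ω, (1 : ℝ) ∂μ ≤ ∫ ω, expIndepNum gs (P.ctx t ω) ∂μ := by
        refine integral_mono_ae (integrable_const _) (hR.integrable_expIndepNum ht) ?_
        filter_upwards [hR.graphLaws_nonempty hI ht] with ω hω
        exact one_le_expIndepNum hK hω
      simpa using h1

lemma IsRealizable.sumIndep_le (hR : P.IsRealizable T ℋ μ 𝓕 𝓖 fs gs) :
    P.sumIndep T μ gs ≤ K * T := by
  rw [hR.sumIndep_eq]
  calc ∑ t ∈ range T, ∫ ω, expIndepNum gs (P.ctx t ω) ∂μ ≤ ∑ t ∈ range T, (K : ℝ) := by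
        refine Finset.sum_le_sum fun t ht => ?_
        have h1 : ∫ ω, expIndepNum gs (P.ctx t ω) ∂μ ≤ ∫ _ω, (K : ℝ) ∂μ :=
          integral_mono (hR.integrable_expIndepNum (Finset.mem_range.1 ht)) (integrable_const _)
            fun ω => expIndepNum_le _ _
        simpa using h1
    _ = K * T := by simp [mul_comm]

end Play

/-! ### Expected estimation errors of the two oracles. -/

namespace Play

variable {K T : ℕ} {X : Type u} {Ω : Type v} {fs : X → Fin K → ℝ} {gs : X → Fin K → Fin K → ℝ}
  {P : Play K X Ω} {t : ℕ}

/-- The squared Hellinger-type distance between the true and the estimated mean graph in round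
`t`. -/
noncomputable def hellinger (P : Play K X Ω) (gs : X → Fin K → Fin K → ℝ) (t : ℕ) (ω : Ω) : ℝ :=
  ∑ i, ∑ j, (√(gs (P.ctx t ω) i j) - √(P.graphEst t ω (P.ctx t ω) i j)) ^ 2

/-- The expected squared estimation error on the observed losses in round `t`. -/
noncomputable def sqError (P : Play K X Ω) (fs : X → Fin K → ℝ) (gs : X → Fin K → Fin K → ℝ)
    (t : ℕ) (ω : Ω) : ℝ :=
  ∑ i, ∑ j, P.strat t ω i *
    (gs (P.ctx t ω) i j * (P.lossEst t ω (P.ctx t ω) j - fs (P.ctx t ω) j) ^ 2)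

lemma hellinger_nonneg (ω : Ω) : 0 ≤ P.hellinger gs t ω :=
  Finset.sum_nonneg fun _ _ => Finset.sum_nonneg fun _ _ => sq_nonneg _

variable [mΩ : MeasurableSpace Ω] {μ : Measure Ω} {ℋ : Filtration ℕ mΩ}
  {𝓕 : Set (X → Fin K → ℝ)} {𝓖 : Set (X → Fin K → Fin K → ℝ)} {regSq regLog γ : ℝ}

lemma aemeasurable_hellinger_term [MeasurableSpace X] (hI : P.IsInteraction T ℋ)
    (hR : P.IsRealizable T ℋ μ 𝓕 𝓖 fs gs) (ht : t < T) (i j : Fin K) :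
    AEMeasurable (fun ω =>
      (√(gs (P.ctx t ω) i j) - √(P.graphEst t ω (P.ctx t ω) i j)) ^ 2) μ := by
  have h1 := ((hR.aestronglyMeasurable_gs ht i j).mono (ℋ.le t)).aemeasurable
  have h2 := ((hI.graphEst_meas t ht i j).mono (ℋ.le t) le_rfl).aemeasurable (μ := μ)
  exact ((Real.continuous_sqrt.measurable.comp_aemeasurable h1).sub
    (Real.continuous_sqrt.measurable.comp_aemeasurable h2)).pow_const 2

lemma IsSquareCBUG.strat_le_one (hA : P.IsSquareCBUG T ℋ μ γ) (ht : t < T) (ω : Ω) (i : Fin K) :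
    P.strat t ω i ≤ 1 := by
  rw [← (hA.strat_mem t ht ω).2]
  exact Finset.single_le_sum (fun i _ => (hA.strat_mem t ht ω).1 i) (Finset.mem_univ i)

lemma measurable_strat [MeasurableSpace X] (hI : P.IsInteraction T ℋ)
    (ht : t < T) (i : Fin K) :
    Measurable[ℋ t] fun ω => P.strat t ω i :=
  (measurable_pi_apply i).comp (hI.strat_meas t ht)

lemma abs_sq_sub_sub_sq_sub_le {a b l : ℝ} (ha : a ∈ Set.Icc (0 : ℝ) 1)
    (hb : b ∈ Set.Icc (0 : ℝ) 1) (hl : l ∈ Set.Icc (0 : ℝ) 1) :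
    |(a - l) ^ 2 - (b - l) ^ 2| ≤ 1 := by
  obtain ⟨a0, a1⟩ := ha
  obtain ⟨b0, b1⟩ := hb
  obtain ⟨l0, l1⟩ := hl
  have h1 : (a - l) ^ 2 ≤ 1 := sq_le_one_iff_abs_le_one _ |>.2 (abs_le.2 ⟨by linarith, by linarith⟩)
  have h2 : (b - l) ^ 2 ≤ 1 := sq_le_one_iff_abs_le_one _ |>.2 (abs_le.2 ⟨by linarith, by linarith⟩)
  rw [abs_le]
  constructor <;> nlinarith [sq_nonneg (a - l), sq_nonneg (b - l)]

lemma integrable_fs (hR : P.IsRealizable T ℋ μ 𝓕 𝓖 fs gs) (ht : t < T) (i : Fin K) :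
    Integrable (fun ω => fs (P.ctx t ω) i) μ :=
  integrable_condExp.congr (hR.mean_loss t ht i)

lemma iInf_fs_mem_Icc [NeZero K] (hR : P.IsRealizable T ℋ μ 𝓕 𝓖 fs gs) (x : X) :
    ⨅ i, fs x i ∈ Set.Icc (0 : ℝ) 1 :=
  ⟨le_ciInf fun i => (hR.fs_mem_Icc x i).1,
    (ciInf_le (Set.finite_range _).bddBelow 0).trans (hR.fs_mem_Icc x 0).2⟩

lemma regret_eq_zero_of_le_one (hK : K ≤ 1) : P.regret T μ fs = 0 := by
  have : Subsingleton (Fin K) := Fin.subsingleton_iff_le_one.2 hK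
  have h : ∀ t ω, fs (P.ctx t ω) (P.act t ω) - ⨅ i, fs (P.ctx t ω) i = 0 := by
    intro t ω
    -- The action played is itself the inhabitant, so `K = 0` needs no separate treatment.
    have : Unique (Fin K) := Unique.mk' (α := Fin K) (h₁ := ⟨P.act t ω⟩)
    rw [ciInf_unique, Subsingleton.elim (P.act t ω) default, sub_self]
  simp [regret, h]

variable [IsProbabilityMeasure μ]

/-- Conditioning replaces the random edge by its mean, after which the inequality is the pointwise
comparison of divergence and Hellinger distance. Finiteness of the loss of `gs`, an entropy, allows
its later cancellation in `ℝ≥0∞`. -/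
lemma lintegral_logLoss_add_hellinger_le [MeasurableSpace X] (hI : P.IsInteraction T ℋ)
    (hR : P.IsRealizable T ℋ μ 𝓕 𝓖 fs gs) (hG : P.LogLossOracle T μ 𝓖 regLog) (ht : t < T)
    (i j : Fin K) :
    ∫⁻ ω, logLoss (gs (P.ctx t ω) i j) ((P.graph t ω).ind i j) ∂μ
        + ∫⁻ ω, ENNReal.ofReal
            ((√(gs (P.ctx t ω) i j) - √(P.graphEst t ω (P.ctx t ω) i j)) ^ 2) ∂μ
      ≤ ∫⁻ ω, logLoss (P.graphEst t ω (P.ctx t ω) i j) ((P.graph t ω).ind i j) ∂μ ∧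
    ∫⁻ ω, logLoss (gs (P.ctx t ω) i j) ((P.graph t ω).ind i j) ∂μ ≠ ⊤ := by
  have hm := ℋ.le t
  have hbm := hI.measurable_of_graph ht fun E => E.ind i j
  have hb01 : ∀ ω, (P.graph t ω).ind i j ∈ Set.Icc (0 : ℝ) 1 := fun ω =>
    ⟨FeedbackGraph.ind_nonneg _ _ _, FeedbackGraph.ind_le_one _ _ _⟩
  have hh := hR.mean_graph t ht i j
  have hgs := (hR.aestronglyMeasurable_gs ht i j).mono hm
  set c := μ[fun ω => (P.graph t ω).ind i j | ℋ t] with hc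
  have hcm : Measurable[ℋ t] c := stronglyMeasurable_condExp.measurable
  have hest := lintegral_logLoss_eq_of_condExp hm hbm hb01 hh (hI.graphEst_meas t ht i j)
  have htrue : ∫⁻ ω, logLoss (gs (P.ctx t ω) i j) ((P.graph t ω).ind i j) ∂μ
      = ∫⁻ ω, logLoss (gs (P.ctx t ω) i j) (gs (P.ctx t ω) i j) ∂μ := by
    -- The prediction `gs (x_t)` is `ℋ t`-measurable only up to a null set, hence the passage
    -- through the version `c`.
    calc ∫⁻ ω, logLoss (gs (P.ctx t ω) i j) ((P.graph t ω).ind i j) ∂μ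
        = ∫⁻ ω, logLoss (c ω) ((P.graph t ω).ind i j) ∂μ := by
          refine lintegral_congr_ae ?_
          filter_upwards [hh] with ω hω
          rw [← hω]
      _ = ∫⁻ ω, logLoss (c ω) (gs (P.ctx t ω) i j) ∂μ :=
          lintegral_logLoss_eq_of_condExp hm hbm hb01 hh hcm
      _ = _ := by
          refine lintegral_congr_ae ?_
          filter_upwards [hh] with ω hω
          rw [hω]
  rw [hest, htrue]
  refine ⟨?_, ?_⟩
  · rw [← lintegral_add_left' (hgs.aemeasurable.logLoss hgs.aemeasurable)]
    exact lintegral_mono fun ω => logLoss_self_add_hellinger_le (hR.gs_mem_Icc _ i j)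
      (hR.graphEst_mem_Icc hG ht ω _ i j)
  · refine ne_top_of_le_ne_top (b := 2) (by simp) ?_
    calc ∫⁻ ω, logLoss (gs (P.ctx t ω) i j) (gs (P.ctx t ω) i j) ∂μ ≤ ∫⁻ _ω, 2 ∂μ :=
          lintegral_mono fun ω => logLoss_self_le (hR.gs_mem_Icc _ i j)
      _ = 2 := by simp

lemma integrable_hellinger [MeasurableSpace X] (hI : P.IsInteraction T ℋ)
    (hR : P.IsRealizable T ℋ μ 𝓕 𝓖 fs gs)
    (hG : P.LogLossOracle T μ 𝓖 regLog) (ht : t < T) : Integrable (P.hellinger gs t) μ := by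
  refine integrable_finsetSum _ fun i _ => integrable_finsetSum _ fun j _ =>
    Integrable.of_bound (aemeasurable_hellinger_term hI hR ht i j).aestronglyMeasurable 1
      (ae_of_all _ fun ω => ?_)
  have h1 := hR.gs_mem_Icc (P.ctx t ω) i j
  have h2 := hR.graphEst_mem_Icc hG ht ω (P.ctx t ω) i j
  have h3 := Real.sqrt_le_one.2 h1.2
  have h4 := Real.sqrt_le_one.2 h2.2
  rw [Real.norm_of_nonneg (sq_nonneg _), sq_le_one_iff_abs_le_one, abs_le]
  constructor <;> linarith [Real.sqrt_nonneg (gs (P.ctx t ω) i j),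
    Real.sqrt_nonneg (P.graphEst t ω (P.ctx t ω) i j)]

/-- The log loss regret controls the distance of the estimated mean graphs to the true ones. -/
lemma sum_integral_hellinger_le [MeasurableSpace X] (hI : P.IsInteraction T ℋ)
    (hR : P.IsRealizable T ℋ μ 𝓕 𝓖 fs gs) (hG : P.LogLossOracle T μ 𝓖 regLog) {R : ℝ}
    (hR0 : 0 ≤ R) (hreg : regLog ≤ R) :
    ∑ t ∈ range T, ∫ ω, P.hellinger gs t ω ∂μ ≤ R := by
  have hm1 : ∀ t ∈ range T, ∀ i j, AEMeasurable
      (fun ω => logLoss (P.graphEst t ω (P.ctx t ω) i j) ((P.graph t ω).ind i j)) μ := by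
    intro t ht i j
    have ht := Finset.mem_range.1 ht
    exact ((hI.graphEst_meas t ht i j).mono (ℋ.le t) le_rfl).aemeasurable.logLoss
      (hI.measurable_of_graph ht fun E => E.ind i j).aemeasurable
  have hm2 : ∀ t ∈ range T, ∀ i j, AEMeasurable
      (fun ω => logLoss (gs (P.ctx t ω) i j) ((P.graph t ω).ind i j)) μ := by
    intro t ht i j
    have ht := Finset.mem_range.1 ht
    exact ((hR.aestronglyMeasurable_gs ht i j).mono (ℋ.le t)).aemeasurable.logLoss
      (hI.measurable_of_graph ht fun E => E.ind i j).aemeasurable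
  have horacle : ∫⁻ ω, ∑ t ∈ range T, ∑ i, ∑ j,
        logLoss (P.graphEst t ω (P.ctx t ω) i j) ((P.graph t ω).ind i j) ∂μ
      ≤ ∫⁻ ω, ∑ t ∈ range T, ∑ i, ∑ j,
          logLoss (gs (P.ctx t ω) i j) ((P.graph t ω).ind i j) ∂μ + ENNReal.ofReal R := by
    calc _ ≤ ∫⁻ ω, ((∑ t ∈ range T, ∑ i, ∑ j,
          logLoss (gs (P.ctx t ω) i j) ((P.graph t ω).ind i j)) + ENNReal.ofReal R) ∂μ := by
          refine lintegral_mono_ae ?_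
          filter_upwards [hG.regret_le] with ω hω
          exact hω.trans (add_le_add (iInf_le (fun g : 𝓖 => ∑ t ∈ range T, ∑ i, ∑ j,
            logLoss (g.1 (P.ctx t ω) i j) ((P.graph t ω).ind i j)) ⟨gs, hR.gs_mem⟩)
            (ENNReal.ofReal_le_ofReal hreg))
      _ = _ := by
          rw [lintegral_add_right _ measurable_const]
          simp
  rw [lintegral_sum_sum_sum _ hm1, lintegral_sum_sum_sum _ hm2] at horacle
  have hkl : ∑ t ∈ range T, ∑ i, ∑ j,
        ∫⁻ ω, logLoss (gs (P.ctx t ω) i j) ((P.graph t ω).ind i j) ∂μ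
      + ∑ t ∈ range T, ∫⁻ ω, ENNReal.ofReal (P.hellinger gs t ω) ∂μ
      ≤ ∑ t ∈ range T, ∑ i, ∑ j,
        ∫⁻ ω, logLoss (P.graphEst t ω (P.ctx t ω) i j) ((P.graph t ω).ind i j) ∂μ := by
    rw [← Finset.sum_add_distrib]
    refine Finset.sum_le_sum fun t ht => ?_
    have ht := Finset.mem_range.1 ht
    have hmt := aemeasurable_hellinger_term hI hR ht
    have hexp : ∫⁻ ω, ENNReal.ofReal (P.hellinger gs t ω) ∂μ = ∑ i, ∑ j, ∫⁻ ω, ENNReal.ofReal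
        ((√(gs (P.ctx t ω) i j) - √(P.graphEst t ω (P.ctx t ω) i j)) ^ 2) ∂μ := by
      have : ∀ ω, ENNReal.ofReal (P.hellinger gs t ω) = ∑ i, ∑ j, ENNReal.ofReal
          ((√(gs (P.ctx t ω) i j) - √(P.graphEst t ω (P.ctx t ω) i j)) ^ 2) := by
        intro ω
        rw [hellinger, ENNReal.ofReal_sum_of_nonneg fun i _ =>
          Finset.sum_nonneg fun j _ => sq_nonneg _]
        exact Finset.sum_congr rfl fun i _ =>
          ENNReal.ofReal_sum_of_nonneg fun j _ => sq_nonneg _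
      simp_rw [this]
      rw [lintegral_finsetSum' _ fun i _ => Finset.aemeasurable_fun_sum _ fun j _ =>
        (hmt i j).ennreal_ofReal]
      exact Finset.sum_congr rfl fun i _ =>
        lintegral_finsetSum' _ fun j _ => (hmt i j).ennreal_ofReal
    rw [hexp, ← Finset.sum_add_distrib]
    refine Finset.sum_le_sum fun i _ => ?_
    rw [← Finset.sum_add_distrib]
    exact Finset.sum_le_sum fun j _ => (lintegral_logLoss_add_hellinger_le hI hR hG ht i j).1
  have hfin : ∑ t ∈ range T, ∑ i, ∑ j,
      ∫⁻ ω, logLoss (gs (P.ctx t ω) i j) ((P.graph t ω).ind i j) ∂μ ≠ ⊤ :=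
    ENNReal.sum_ne_top.2 fun t ht => ENNReal.sum_ne_top.2 fun i _ => ENNReal.sum_ne_top.2 fun j _ =>
      (lintegral_logLoss_add_hellinger_le hI hR hG (Finset.mem_range.1 ht) i j).2
  have hle := (ENNReal.add_le_add_iff_left hfin).1 (hkl.trans horacle)
  have hreal : ∑ t ∈ range T, ∫⁻ ω, ENNReal.ofReal (P.hellinger gs t ω) ∂μ
      = ENNReal.ofReal (∑ t ∈ range T, ∫ ω, P.hellinger gs t ω ∂μ) := by
    rw [ENNReal.ofReal_sum_of_nonneg fun t _ => integral_nonneg fun ω => hellinger_nonneg ω]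
    exact Finset.sum_congr rfl fun t ht => (ofReal_integral_eq_lintegral_ofReal
      (integrable_hellinger hI hR hG (Finset.mem_range.1 ht))
      (ae_of_all _ fun ω => hellinger_nonneg ω)).symm
  rw [hreal] at hle
  exact (ENNReal.ofReal_le_ofReal_iff hR0).1 hle

lemma integrable_actInd [MeasurableSpace X] (hI : P.IsInteraction T ℋ)
    (ht : t < T) (i : Fin K) :
    Integrable (fun ω => if P.act t ω = i then (1 : ℝ) else 0) μ :=
  Integrable.of_bound (hI.measurable_actInd ht i).aestronglyMeasurable 1 (ae_of_all _ fun ω => by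
    split_ifs <;> simp)

/-- The expected excess square loss of the estimator `f_t` on the action `j`, when observed
through `i`. -/
lemma integral_excess_sq_loss [MeasurableSpace X] (hI : P.IsInteraction T ℋ)
    (hR : P.IsRealizable T ℋ μ 𝓕 𝓖 fs gs)
    (hS : P.SquareLossOracle T μ 𝓕 regSq) (hA : P.IsSquareCBUG T ℋ μ γ) (ht : t < T)
    (i j : Fin K) :
    Integrable (fun ω => (P.graph t ω).ind i j *
        ((P.lossEst t ω (P.ctx t ω) j - P.loss t ω j) ^ 2 - (fs (P.ctx t ω) j - P.loss t ω j) ^ 2)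
        * (if P.act t ω = i then (1 : ℝ) else 0)) μ ∧
    Integrable (fun ω => P.strat t ω i *
      (gs (P.ctx t ω) i j * (P.lossEst t ω (P.ctx t ω) j - fs (P.ctx t ω) j) ^ 2)) μ ∧
    ∫ ω, (P.graph t ω).ind i j *
        ((P.lossEst t ω (P.ctx t ω) j - P.loss t ω j) ^ 2 - (fs (P.ctx t ω) j - P.loss t ω j) ^ 2)
        * (if P.act t ω = i then (1 : ℝ) else 0) ∂μ
      = ∫ ω, P.strat t ω i *
          (gs (P.ctx t ω) i j * (P.lossEst t ω (P.ctx t ω) j - fs (P.ctx t ω) j) ^ 2) ∂μ := by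
  have hm := ℋ.le t
  have hm' := hI.beforeAct_le (P := P) ht
  set F : Ω → ℝ := fun ω => P.lossEst t ω (P.ctx t ω) j with hF
  set s : Ω → ℝ := fun ω => fs (P.ctx t ω) j with hs
  set l : Ω → ℝ := fun ω => P.loss t ω j with hl
  set b : Ω → ℝ := fun ω => (P.graph t ω).ind i j with hb
  set p : Ω → ℝ := fun ω => P.strat t ω i with hp
  set G : Ω → ℝ := fun ω => gs (P.ctx t ω) i j with hG
  have F01 : ∀ ω, F ω ∈ Set.Icc (0 : ℝ) 1 := fun ω => hR.lossEst_mem_Icc hS ht ω _ j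
  have s01 : ∀ ω, s ω ∈ Set.Icc (0 : ℝ) 1 := fun ω => hR.fs_mem_Icc _ j
  have l01 : ∀ ω, l ω ∈ Set.Icc (0 : ℝ) 1 := fun ω => hI.loss_mem t ht ω j
  have b01 : ∀ ω, b ω ∈ Set.Icc (0 : ℝ) 1 := fun ω =>
    ⟨FeedbackGraph.ind_nonneg _ _ _, FeedbackGraph.ind_le_one _ _ _⟩
  have p01 : ∀ ω, p ω ∈ Set.Icc (0 : ℝ) 1 := fun ω =>
    ⟨(hA.strat_mem t ht ω).1 i, hA.strat_le_one ht ω i⟩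
  have G01 : ∀ ω, G ω ∈ Set.Icc (0 : ℝ) 1 := fun ω => hR.gs_mem_Icc _ i j
  have Fm : AEStronglyMeasurable[ℋ t] F μ :=
    (hI.lossEst_meas t ht j).stronglyMeasurable.aestronglyMeasurable
  have sm : AEStronglyMeasurable[ℋ t] s μ := hR.aestronglyMeasurable_fs ht j
  have pm : AEStronglyMeasurable[ℋ t] p μ :=
    (measurable_strat hI ht i).stronglyMeasurable.aestronglyMeasurable
  have Gm : AEStronglyMeasurable[ℋ t] G μ := hR.aestronglyMeasurable_gs ht i j
  have lm : AEStronglyMeasurable[P.beforeAct ℋ t] l μ :=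
    ((measurable_pi_apply j).comp
      measurable_loss_beforeAct).stronglyMeasurable.aestronglyMeasurable
  have bm : AEStronglyMeasurable[P.beforeAct ℋ t] b μ :=
    (measurable_of_graph_beforeAct
      fun E => E.ind i j).stronglyMeasurable.aestronglyMeasurable
  have Ym : AEStronglyMeasurable[P.beforeAct ℋ t]
      (fun ω => b ω * ((F ω - l ω) ^ 2 - (s ω - l ω) ^ 2)) μ :=
    bm.mul ((((Fm.mono le_beforeAct).sub lm).pow 2).sub (((sm.mono le_beforeAct).sub lm).pow 2))
  have Yb : ∀ ω, ‖b ω * ((F ω - l ω) ^ 2 - (s ω - l ω) ^ 2)‖ ≤ 1 := by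
    intro ω
    rw [norm_mul, Real.norm_of_nonneg (b01 ω).1, Real.norm_eq_abs]
    exact mul_le_one₀ (b01 ω).2 (abs_nonneg _)
      (abs_sq_sub_sub_sq_sub_le (F01 ω) (s01 ω) (l01 ω))
  have hact := integrable_actInd (μ := μ) hI ht i
  have i1 : Integrable (fun ω => b ω * ((F ω - l ω) ^ 2 - (s ω - l ω) ^ 2)
      * (if P.act t ω = i then (1 : ℝ) else 0)) μ :=
    hact.bdd_mul (Ym.mono hm') (ae_of_all _ Yb)
  have i2 : Integrable (fun ω => p ω * (G ω * (F ω - s ω) ^ 2)) μ := by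
    refine Integrable.of_bound ((pm.mul (Gm.mul ((Fm.sub sm).pow 2))).mono hm) 1
      (ae_of_all _ fun ω => ?_)
    have h1 : (F ω - s ω) ^ 2 ≤ 1 := sq_le_one_iff_abs_le_one _ |>.2
      (abs_le.2 ⟨by linarith [(F01 ω).1, (s01 ω).2], by linarith [(F01 ω).2, (s01 ω).1]⟩)
    have h2 : 0 ≤ G ω * (F ω - s ω) ^ 2 := mul_nonneg (G01 ω).1 (sq_nonneg _)
    rw [Real.norm_of_nonneg (mul_nonneg (p01 ω).1 h2)]
    exact mul_le_one₀ (p01 ω).2 h2 (mul_le_one₀ (G01 ω).2 (sq_nonneg _) h1)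
  refine ⟨i1, i2, ?_⟩
  have bint : Integrable b μ := Integrable.of_bound (bm.mono hm') 1 (ae_of_all _ fun ω => by
    rw [Real.norm_of_nonneg (b01 ω).1]; exact (b01 ω).2)
  have blint : Integrable (fun ω => b ω * l ω) μ :=
    Integrable.of_bound ((bm.mul lm).mono hm') 1 (ae_of_all _ fun ω => by
      rw [Real.norm_of_nonneg (mul_nonneg (b01 ω).1 (l01 ω).1)]
      exact mul_le_one₀ (b01 ω).2 (l01 ω).1 (l01 ω).2)
  have Z1m : AEStronglyMeasurable[ℋ t] (fun ω => p ω * (F ω ^ 2 - s ω ^ 2)) μ :=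
    pm.mul ((Fm.pow 2).sub (sm.pow 2))
  have Z2m : AEStronglyMeasurable[ℋ t] (fun ω => p ω * (F ω - s ω)) μ := pm.mul (Fm.sub sm)
  have Z1b : ∀ ω, ‖p ω * (F ω ^ 2 - s ω ^ 2)‖ ≤ 1 := by
    intro ω
    rw [norm_mul, Real.norm_of_nonneg (p01 ω).1, Real.norm_eq_abs]
    have := abs_sq_sub_sub_sq_sub_le (F01 ω) (s01 ω) (l := 0) (by simp)
    simp only [sub_zero] at this
    exact mul_le_one₀ (p01 ω).2 (abs_nonneg _) this
  have Z2b : ∀ ω, ‖p ω * (F ω - s ω)‖ ≤ 1 := by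
    intro ω
    rw [norm_mul, Real.norm_of_nonneg (p01 ω).1, Real.norm_eq_abs]
    exact mul_le_one₀ (p01 ω).2 (abs_nonneg _)
      (abs_le.2 ⟨by linarith [(F01 ω).1, (s01 ω).2], by linarith [(F01 ω).2, (s01 ω).1]⟩)
  have e1 := integral_mul_eq_of_condExp hm bint (hR.mean_graph t ht i j) Z1m (ae_of_all _ Z1b)
  have e2 := integral_mul_eq_of_condExp hm blint (hR.uncorrelated t ht i j) Z2m (ae_of_all _ Z2b)
  have Gint : Integrable G μ := integrable_condExp.congr (hR.mean_graph t ht i j)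
  have Gsint : Integrable (fun ω => G ω * s ω) μ :=
    integrable_condExp.congr (hR.uncorrelated t ht i j)
  have j1 := bint.bdd_mul (Z1m.mono hm) (ae_of_all _ Z1b)
  have j2 := blint.bdd_mul (Z2m.mono hm) (ae_of_all _ Z2b)
  have j3 := Gint.bdd_mul (Z1m.mono hm) (ae_of_all _ Z1b)
  have j4 := Gsint.bdd_mul (Z2m.mono hm) (ae_of_all _ Z2b)
  -- Conditioning on `beforeAct` replaces the action indicator by `p`. The `l²` terms cancel, so the
  -- excess loss involves only `b` and `b * l`, whose conditional means given `ℋ t` are `G` and `G *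
  -- s`; the cross terms then recombine to `(F - s)²`.
  calc ∫ ω, b ω * ((F ω - l ω) ^ 2 - (s ω - l ω) ^ 2)
        * (if P.act t ω = i then (1 : ℝ) else 0) ∂μ
      = ∫ ω, b ω * ((F ω - l ω) ^ 2 - (s ω - l ω) ^ 2) * p ω ∂μ :=
        integral_mul_eq_of_condExp hm' hact (hA.act_sample t ht i) Ym (ae_of_all _ Yb)
    _ = ∫ ω, (p ω * (F ω ^ 2 - s ω ^ 2) * b ω - 2 * (p ω * (F ω - s ω) * (b ω * l ω))) ∂μ :=
        integral_congr_ae (ae_of_all _ fun ω => by simp only; ring)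
    _ = ∫ ω, (p ω * (F ω ^ 2 - s ω ^ 2) * G ω - 2 * (p ω * (F ω - s ω) * (G ω * s ω))) ∂μ := by
        rw [integral_sub j1 (j2.const_mul 2), integral_sub j3 (j4.const_mul 2),
          integral_const_mul, integral_const_mul, e1, e2]
    _ = ∫ ω, p ω * (G ω * (F ω - s ω) ^ 2) ∂μ :=
        integral_congr_ae (ae_of_all _ fun ω => by simp only; ring)

lemma integrable_sqError [MeasurableSpace X] (hI : P.IsInteraction T ℋ)
    (hR : P.IsRealizable T ℋ μ 𝓕 𝓖 fs gs)
    (hS : P.SquareLossOracle T μ 𝓕 regSq) (hA : P.IsSquareCBUG T ℋ μ γ) (ht : t < T) :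
    Integrable (P.sqError fs gs t) μ :=
  integrable_finsetSum _ fun i _ => integrable_finsetSum _ fun j _ =>
    (integral_excess_sq_loss hI hR hS hA ht i j).2.1

/-- The square loss regret controls the squared estimation error on the observed losses. -/
lemma sum_integral_sqError_le [MeasurableSpace X] (hI : P.IsInteraction T ℋ)
    (hR : P.IsRealizable T ℋ μ 𝓕 𝓖 fs gs)
    (hS : P.SquareLossOracle T μ 𝓕 regSq) (hA : P.IsSquareCBUG T ℋ μ γ) :
    ∑ t ∈ range T, ∫ ω, P.sqError fs gs t ω ∂μ ≤ regSq := by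
  let Y : ℕ → Fin K → Fin K → Ω → ℝ := fun t i j ω => (P.graph t ω).ind i j *
    ((P.lossEst t ω (P.ctx t ω) j - P.loss t ω j) ^ 2 - (fs (P.ctx t ω) j - P.loss t ω j) ^ 2)
    * (if P.act t ω = i then (1 : ℝ) else 0)
  have hY : ∀ t ∈ range T, ∀ i j, Integrable (Y t i j) μ := fun t ht i j =>
    (integral_excess_sq_loss hI hR hS hA (Finset.mem_range.1 ht) i j).1
  have hobs : ∀ t ω, ∑ i, ∑ j, Y t i j ω = ∑ j ∈ P.observed t ω,
      ((P.lossEst t ω (P.ctx t ω) j - P.loss t ω j) ^ 2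
        - (fs (P.ctx t ω) j - P.loss t ω j) ^ 2) := by
    intro t ω
    rw [Finset.sum_eq_single (P.act t ω)]
    · rw [observed, FeedbackGraph.out, Finset.sum_filter]
      refine Finset.sum_congr rfl fun j _ => ?_
      simp only [Y, FeedbackGraph.ind]
      split_ifs <;> simp
    · intro i _ hi
      refine Finset.sum_eq_zero fun j _ => ?_
      simp [Y, hi.symm]
    · simp
  have hle : ∀ᵐ ω ∂μ, ∑ t ∈ range T, ∑ i, ∑ j, Y t i j ω ≤ regSq := by
    filter_upwards [hS.regret_le] with ω hω
    have h1 : ⨅ f : 𝓕, ∑ t ∈ range T, ∑ j ∈ P.observed t ω,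
          (f.1 (P.ctx t ω) j - P.loss t ω j) ^ 2
        ≤ ∑ t ∈ range T, ∑ j ∈ P.observed t ω, (fs (P.ctx t ω) j - P.loss t ω j) ^ 2 :=
      ciInf_le (f := fun f : 𝓕 => ∑ t ∈ range T, ∑ j ∈ P.observed t ω,
        (f.1 (P.ctx t ω) j - P.loss t ω j) ^ 2) ⟨0, by
          rintro _ ⟨f, rfl⟩
          exact Finset.sum_nonneg fun _ _ => Finset.sum_nonneg fun _ _ => sq_nonneg _⟩
        ⟨fs, hR.fs_mem⟩
    simp_rw [hobs, Finset.sum_sub_distrib]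
    linarith
  have hint : ∫ ω, ∑ t ∈ range T, ∑ i, ∑ j, Y t i j ω ∂μ
      = ∑ t ∈ range T, ∫ ω, P.sqError fs gs t ω ∂μ := by
    rw [integral_finsetSum _ fun t ht => integrable_finsetSum _ fun i _ =>
      integrable_finsetSum _ fun j _ => hY t ht i j]
    refine Finset.sum_congr rfl fun t ht => ?_
    have hex := fun i j => integral_excess_sq_loss hI hR hS hA (Finset.mem_range.1 ht) i j
    simp only [sqError]
    rw [integral_finsetSum _ fun i _ => integrable_finsetSum _ fun j _ => hY t ht i j,
      integral_finsetSum _ fun i _ => integrable_finsetSum _ fun j _ => (hex i j).2.1]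
    refine Finset.sum_congr rfl fun i _ => ?_
    rw [integral_finsetSum _ fun j _ => hY t ht i j,
      integral_finsetSum _ fun j _ => (hex i j).2.1]
    exact Finset.sum_congr rfl fun j _ => (hex i j).2.2
  rw [← hint]
  calc ∫ ω, ∑ t ∈ range T, ∑ i, ∑ j, Y t i j ω ∂μ ≤ ∫ _ω, regSq ∂μ :=
        integral_mono_ae (integrable_finsetSum _ fun t ht => integrable_finsetSum _ fun i _ =>
          integrable_finsetSum _ fun j _ => hY t ht i j) (integrable_const _) hle
    _ = regSq := by simp

/-! ### The regret -/

lemma integrable_iInf_fs [NeZero K] (hR : P.IsRealizable T ℋ μ 𝓕 𝓖 fs gs) (ht : t < T) :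
    Integrable (fun ω => ⨅ i, fs (P.ctx t ω) i) μ := by
  refine Integrable.of_bound (AEMeasurable.iInf fun i =>
    (integrable_fs hR ht i).aemeasurable).aestronglyMeasurable 1 (ae_of_all _ fun ω => ?_)
  rw [Real.norm_of_nonneg (iInf_fs_mem_Icc hR _).1]
  exact (iInf_fs_mem_Icc hR _).2

/-- The regret of one round, averaged over the choice of the action. -/
lemma integral_round_regret [MeasurableSpace X] [NeZero K] (hI : P.IsInteraction T ℋ)
    (hR : P.IsRealizable T ℋ μ 𝓕 𝓖 fs gs) (hA : P.IsSquareCBUG T ℋ μ γ) (ht : t < T) :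
    Integrable (fun ω => fs (P.ctx t ω) (P.act t ω) - ⨅ i, fs (P.ctx t ω) i) μ ∧
    Integrable (fun ω => ∑ i, P.strat t ω i * fs (P.ctx t ω) i - ⨅ i, fs (P.ctx t ω) i) μ ∧
    ∫ ω, (fs (P.ctx t ω) (P.act t ω) - ⨅ i, fs (P.ctx t ω) i) ∂μ
      = ∫ ω, (∑ i, P.strat t ω i * fs (P.ctx t ω) i - ⨅ i, fs (P.ctx t ω) i) ∂μ := by
  have hm' := hI.beforeAct_le (P := P) ht
  have hact : ∀ ω, fs (P.ctx t ω) (P.act t ω)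
      = ∑ i, fs (P.ctx t ω) i * (if P.act t ω = i then (1 : ℝ) else 0) := by
    intro ω; simp
  have hb : ∀ i ω, ‖fs (P.ctx t ω) i‖ ≤ 1 := fun i ω => by
    rw [Real.norm_of_nonneg (hR.fs_mem_Icc _ i).1]; exact (hR.fs_mem_Icc _ i).2
  have hfm : ∀ i, AEStronglyMeasurable[P.beforeAct ℋ t] (fun ω => fs (P.ctx t ω) i) μ := fun i =>
    (hR.aestronglyMeasurable_fs ht i).mono le_beforeAct
  have i1 : ∀ i, Integrable (fun ω => fs (P.ctx t ω) i
      * (if P.act t ω = i then (1 : ℝ) else 0)) μ := fun i =>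
    (integrable_actInd hI ht i).bdd_mul ((hfm i).mono hm') (ae_of_all _ (hb i))
  have i2 : ∀ i, Integrable (fun ω => P.strat t ω i * fs (P.ctx t ω) i) μ := fun i =>
    (integrable_fs hR ht i).bdd_mul
      ((measurable_strat hI ht i).mono (ℋ.le t) le_rfl).aestronglyMeasurable
      (ae_of_all _ fun ω => by
        rw [Real.norm_of_nonneg ((hA.strat_mem t ht ω).1 i)]
        exact hA.strat_le_one ht ω i)
  have i3 := integrable_iInf_fs hR ht
  simp_rw [hact]
  refine ⟨(integrable_finsetSum _ fun i _ => i1 i).sub i3,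
    (integrable_finsetSum _ fun i _ => i2 i).sub i3, ?_⟩
  rw [integral_sub (integrable_finsetSum _ fun i _ => i1 i) i3,
    integral_sub (integrable_finsetSum _ fun i _ => i2 i) i3,
    integral_finsetSum _ fun i _ => i1 i, integral_finsetSum _ fun i _ => i2 i]
  congr 1
  refine Finset.sum_congr rfl fun i _ => ?_
  rw [integral_mul_eq_of_condExp hm' (integrable_actInd hI ht i) (hA.act_sample t ht i) (hfm i)
    (ae_of_all _ (hb i))]
  exact integral_congr_ae (ae_of_all _ fun ω => mul_comm _ _)

lemma regret_le_rounds [MeasurableSpace X] [NeZero K] (hI : P.IsInteraction T ℋ)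
    (hR : P.IsRealizable T ℋ μ 𝓕 𝓖 fs gs) (hA : P.IsSquareCBUG T ℋ μ γ) :
    P.regret T μ fs ≤ T := by
  rw [regret, integral_finsetSum _ fun t ht =>
    (integral_round_regret hI hR hA (Finset.mem_range.1 ht)).1]
  calc _ ≤ ∑ t ∈ range T, (1 : ℝ) := by
        refine Finset.sum_le_sum fun t ht => ?_
        have h1 := integral_mono (integral_round_regret hI hR hA (Finset.mem_range.1 ht)).1
          (integrable_const (1 : ℝ)) (fun ω => by
            linarith [(hR.fs_mem_Icc (P.ctx t ω) (P.act t ω)).2, (iInf_fs_mem_Icc hR (P.ctx t ω)).1])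
        simpa using h1
    _ = T := by simp

lemma regret_le_of_two_le [MeasurableSpace X] (hK : 2 ≤ K) (hI : P.IsInteraction T ℋ)
    (hR : P.IsRealizable T ℋ μ 𝓕 𝓖 fs gs) (hS : P.SquareLossOracle T μ 𝓕 regSq)
    (hG : P.LogLossOracle T μ 𝓖 regLog) (hA : P.IsSquareCBUG T ℋ μ γ) (hγ : 12 ≤ γ) {R : ℝ}
    (hR0 : 0 ≤ R) (hSq : regSq ≤ R) (hLog : regLog ≤ R) :
    P.regret T μ fs
      ≤ 49 * Real.log (K * γ) / γ * P.sumIndep T μ gs + 5 / 4 * γ * R := by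
  have : NeZero K := ⟨by omega⟩
  have hround : ∀ t ∈ range T, ∫ ω, (fs (P.ctx t ω) (P.act t ω) - ⨅ i, fs (P.ctx t ω) i) ∂μ
      ≤ 49 * Real.log (K * γ) / γ * ∫ ω, expIndepNum gs (P.ctx t ω) ∂μ
        + 3 / 4 * γ * ∫ ω, P.hellinger gs t ω ∂μ + γ / 2 * ∫ ω, P.sqError fs gs t ω ∂μ := by
    intro t ht
    have ht := Finset.mem_range.1 ht
    obtain ⟨-, h2, h3⟩ := integral_round_regret hI hR hA ht
    have j1 := (hR.integrable_expIndepNum ht).const_mul (49 * Real.log (K * γ) / γ)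
    have j2 := (integrable_hellinger hI hR hG ht).const_mul (3 / 4 * γ)
    have j3 := (integrable_sqError hI hR hS hA ht).const_mul (γ / 2)
    have j12 : Integrable (fun ω => 49 * Real.log (K * γ) / γ * expIndepNum gs (P.ctx t ω)
        + 3 / 4 * γ * P.hellinger gs t ω) μ := j1.add j2
    rw [h3, ← integral_const_mul, ← integral_const_mul, ← integral_const_mul,
      ← integral_add j1 j2, ← integral_add j12 j3]
    refine integral_mono_ae h2 (j12.add j3) ?_
    filter_upwards [hR.graphLaws_nonempty hI ht] with ω hω
    exact round_regret_le hK hγ (hR.lossEst_mem_Icc hS ht ω _) (hR.fs_mem_Icc _)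
      (fun i j => (hR.graphEst_mem_Icc hG ht ω _ i j).1) hω (hA.strat_mem t ht ω)
      (hA.strat_argmin t ht ω)
  rw [regret, integral_finsetSum _ fun t ht =>
    (integral_round_regret hI hR hA (Finset.mem_range.1 ht)).1]
  refine (Finset.sum_le_sum hround).trans ?_
  rw [Finset.sum_add_distrib, Finset.sum_add_distrib, ← Finset.mul_sum, ← Finset.mul_sum,
    ← Finset.mul_sum, ← hR.sumIndep_eq]
  have h4 := mul_le_mul_of_nonneg_left (sum_integral_hellinger_le hI hR hG hR0 hLog)
    (by linarith : 0 ≤ 3 / 4 * γ)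
  have h5 := mul_le_mul_of_nonneg_left ((sum_integral_sqError_le hI hR hS hA).trans hSq)
    (by linarith : 0 ≤ γ / 2)
  linarith

lemma regret_le_log_mul_sqrt [MeasurableSpace X] (hK : 2 ≤ K) (hI : P.IsInteraction T ℋ)
    (hR : P.IsRealizable T ℋ μ 𝓕 𝓖 fs gs) (hS : P.SquareLossOracle T μ 𝓕 regSq)
    (hG : P.LogLossOracle T μ 𝓖 regLog) (hA : P.IsSquareCBUG T ℋ μ γ)
    (hpos : 0 < max regSq regLog)
    (hγ : γ = max 12 (√(P.sumIndep T μ gs / max regSq regLog))) :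
    P.regret T μ fs
      ≤ 51 * Real.log (K * γ) * √(P.sumIndep T μ gs * max regSq regLog) := by
  have : NeZero K := ⟨by omega⟩
  have hγ12 : 12 ≤ γ := hγ ▸ le_max_left _ _
  have hL := Real.one_le_log_mul (by omega : 0 < K) hγ12
  have hTA := hR.le_sumIndep hI (by omega : 0 < K)
  have hmain := regret_le_of_two_le hK hI hR hS hG hA hγ12 hpos.le (le_max_left _ _)
    (le_max_right _ _)
  have htriv := regret_le_rounds hI hR hA
  set A := P.sumIndep T μ gs
  set R := max regSq regLog
  set L := Real.log (K * γ)
  have hA0 : 0 ≤ A := (Nat.cast_nonneg T).trans hTA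
  rw [Real.sqrt_div hA0] at hγ
  rw [Real.sqrt_mul hA0]
  have sA := Real.mul_self_sqrt hA0
  have sR := Real.mul_self_sqrt hpos.le
  have pR : 0 < √R := Real.sqrt_pos.2 hpos
  have pA : 0 ≤ √A := Real.sqrt_nonneg A
  have hAR : 0 ≤ √A * √R := mul_nonneg pA pR.le
  -- If `γ = √(A / R)`, then `A / γ = γ R = √(A R)`, and `49 L + 5 / 4 ≤ 51 L` because `1 ≤ L`.
  -- Otherwise `√A ≤ 12 √R`, so the regret is at most `T ≤ A ≤ 12 √(A R)`.
  rcases le_total 12 (√A / √R) with h | h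
  · rw [max_eq_right h] at hγ
    have hA' : √A = γ * √R := by rw [hγ]; field_simp
    have hγ0 : 0 < γ := by linarith
    have hAeq : γ * (√A * √R) = A := by
      calc γ * (√A * √R) = γ * √R * √A := by ring
        _ = A := by rw [← hA', sA]
    have hReq : γ * R = √A * √R := by
      calc γ * R = γ * √R * √R := by rw [mul_assoc, sR]
        _ = √A * √R := by rw [← hA']
    have e1 : 49 * L / γ * A = 49 * L * (√A * √R) := by
      calc 49 * L / γ * A = 49 * L / γ * (γ * (√A * √R)) := by rw [hAeq]
        _ = _ := by field_simp
    have e2 : 5 / 4 * γ * R = 5 / 4 * (√A * √R) := by rw [mul_assoc, hReq]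
    rw [e1, e2] at hmain
    nlinarith [mul_le_mul_of_nonneg_right hL hAR]
  · rw [div_le_iff₀ pR] at h
    have h1 : A ≤ 12 * (√A * √R) := by
      nlinarith [mul_le_mul_of_nonneg_left h pA]
    nlinarith [mul_le_mul_of_nonneg_right hL hAR]

end Play

/-- The parameter of the algorithm is polynomial in `K T`. -/
lemma log_mul_max_sqrt_le {K T : ℕ} (hK : 2 ≤ K) (hT : 1 ≤ T) {A R c : ℝ} (hA : A ≤ K * T)
    (hR : 0 < R) (hc : 0 ≤ c) (hcR : ((K : ℝ) * T) ^ (-c) ≤ R) :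
    Real.log (K * max 12 (√(A / R))) ≤ 6 * (1 + c) * Real.log (K * T) := by
  have hK' : (2 : ℝ) ≤ K := by exact_mod_cast hK
  have hT' : (1 : ℝ) ≤ T := by exact_mod_cast hT
  have hN : (2 : ℝ) ≤ K * T := by nlinarith
  have hKN : (K : ℝ) ≤ K * T := by nlinarith
  generalize (K : ℝ) * T = N at *
  have hN0 : 0 < N := by linarith
  have hlogN : Real.log 2 ≤ Real.log N := Real.log_le_log (by norm_num) hN
  have hlog2 : 0 < Real.log 2 := Real.log_pos (by norm_num)
  -- As `12 ≤ 2⁴` and `2 ≤ N`, the constant contributes at most `4 log N`; then `1 + 4 + (1 + c) / 2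
  -- ≤ 6 (1 + c)`.
  have h12 : Real.log 12 ≤ 4 * Real.log 2 := by
    have : 4 * Real.log 2 = Real.log (2 ^ 4) := by rw [Real.log_pow]; norm_num
    rw [this]
    exact Real.log_le_log (by norm_num) (by norm_num)
  have hAR : A / R ≤ N ^ (1 + c) := by
    rw [div_le_iff₀ hR]
    calc A ≤ N := hA
      _ = N ^ (1 + c) * N ^ (-c) := by
        rw [← Real.rpow_add hN0, add_neg_cancel_right, Real.rpow_one]
      _ ≤ _ := mul_le_mul_of_nonneg_left hcR (Real.rpow_nonneg hN0.le _)
  have hsq : √(A / R) ≤ N ^ ((1 + c) / 2) := by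
    rw [Real.sqrt_le_left (Real.rpow_nonneg hN0.le _), ← Real.rpow_natCast, ← Real.rpow_mul hN0.le]
    simpa using hAR
  have hone : 1 ≤ N ^ ((1 + c) / 2) := Real.one_le_rpow (by linarith) (by positivity)
  have hmax : max 12 (√(A / R)) ≤ 12 * N ^ ((1 + c) / 2) :=
    max_le (by linarith) (by linarith)
  calc Real.log (K * max 12 (√(A / R))) ≤ Real.log (N * (12 * N ^ ((1 + c) / 2))) := by
        refine Real.log_le_log (by positivity) ?_
        exact mul_le_mul hKN hmax (by positivity) hN0.le
    _ = Real.log N + (Real.log 12 + (1 + c) / 2 * Real.log N) := by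
        rw [Real.log_mul hN0.ne' (by positivity), Real.log_mul (by norm_num) (by positivity),
          Real.log_rpow hN0]
    _ ≤ _ := by nlinarith [mul_nonneg hc (hlog2.le.trans hlogN)]

theorem mainTheorem2 :
    ∃ C : ℝ, 0 < C ∧
      ∀ (K T : ℕ) (X : Type u) (Ω : Type v) [MeasurableSpace X] [mΩ : MeasurableSpace Ω]
        (μ : Measure Ω) [IsProbabilityMeasure μ] (ℋ : Filtration ℕ mΩ)
        (𝓕 : Set (X → Fin K → ℝ)) (𝓖 : Set (X → Fin K → Fin K → ℝ))
        (fs : X → Fin K → ℝ) (gs : X → Fin K → Fin K → ℝ)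
        (regSq regLog γ : ℝ) (P : Play K X Ω),
        P.IsInteraction T ℋ →
        P.IsRealizable T ℋ μ 𝓕 𝓖 fs gs →
        P.SquareLossOracle T μ 𝓕 regSq →
        P.LogLossOracle T μ 𝓖 regLog →
        0 < max regSq regLog →
        γ = max 12 (Real.sqrt (P.sumIndep T μ gs / max regSq regLog)) →
        P.IsSquareCBUG T ℋ μ γ →
        P.regret T μ fs
            ≤ C * Real.log (K * γ) * Real.sqrt (P.sumIndep T μ gs * max regSq regLog) ∧
        ∀ c : ℝ, 0 ≤ c → ((K : ℝ) * T) ^ (-c) ≤ max regSq regLog →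
          P.regret T μ fs
            ≤ C * (1 + c) * Real.log (K * T)
                * Real.sqrt (P.sumIndep T μ gs * max regSq regLog) := by
  -- `306 = 51 * 6`: the constant of `regret_le_log_mul_sqrt` times that of `log_mul_max_sqrt_le`.
  refine ⟨306, by norm_num, ?_⟩
  intro K T X Ω _ mΩ μ _ ℋ 𝓕 𝓖 fs gs regSq regLog γ P hI hR hS hG hpos hγ hA
  have hγ12 : 12 ≤ γ := hγ ▸ le_max_left _ _
  have hK0 : 0 < K ∨ K = 0 := by omega
  by_cases hK : 2 ≤ K
  · have hL := Real.one_le_log_mul (by omega : 0 < K) hγ12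
    have h1 := Play.regret_le_log_mul_sqrt hK hI hR hS hG hA hpos hγ
    have hs := Real.sqrt_nonneg (P.sumIndep T μ gs * max regSq regLog)
    refine ⟨h1.trans (mul_le_mul_of_nonneg_right (by linarith) hs), fun c hc hcR => ?_⟩
    rcases T.eq_zero_or_pos with rfl | hT
    · simp [Play.regret]
    refine h1.trans (mul_le_mul_of_nonneg_right ?_ hs)
    have h2 := log_mul_max_sqrt_le hK hT hR.sumIndep_le hpos hc hcR
    rw [← hγ] at h2
    linarith
  -- With at most one action the regret vanishes, and only nonnegativity of the bounds remains; for
  -- `K = 0` the first one is zero because `Real.log 0 = 0`.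
  · rw [Play.regret_eq_zero_of_le_one (by omega)]
    refine ⟨?_, fun c hc _ => ?_⟩
    · rcases hK0 with hK0 | rfl
      · have hL := Real.one_le_log_mul hK0 hγ12
        positivity
      · simp
    · have hlog : 0 ≤ Real.log ((K : ℝ) * T) := by exact_mod_cast Real.log_natCast_nonneg (K * T)
      positivity
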